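/- Let $\gamma\in(0,1)$, $\epsilon>0$, $\mu>0$, $b>0$, $a\le 0$, $c\le 0$, and let $\omega\in\mathbb R$ satisfy $|\omega|<(1-\gamma)\min\{1,|c|/b\}$. Put $J_b=1-\mu b\,\partial_x^2$, $J_c=1+\mu c\,\partial_x^2$ and $$\mathcal L=\frac1\gamma-\frac{\sqrt\mu}{\gamma^2}|D|+\frac{\mu}{\gamma}\Big(a-\frac1{\gamma^2}\Big)\partial_x^2 ,\qquad \widehat{|D|f}(y)=|y|\hat f(y).$$ For $(\xi,\nu)\in H^1(\mathbb R)\times H^1(\mathbb R)$ (real valued) let $$E(\xi,\nu)=\int_{\mathbb R}\frac{1-\gamma}{2}\,\xi J_c\xi+\frac12\,\nu\mathcal L\nu-\omega\,\xi J_b\nu\;dx,\qquad F(\xi,\nu)=\frac{\epsilon}{2\gamma}\int_{\mathbb R}\xi\nu^2\,dx,$$ the first integral being understood in the sense of the $H^1$–$H^{-1}$ pairing. Let $(\xi,\nu)\in H^1(\mathbb R)\times H^1(\mathbb R)$ (continuous representatives) be a solution, in the sense of tempered distributions, of the solitary wave system $$-\omega J_b\xi+\mathcal L\nu=\frac{\epsilon}{\gamma}\,\xi\nu,\qquad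 -\omega J_b\nu+(1-\gamma)J_c\xi=\frac{\epsilon}{2\gamma}\,\nu^2 ,$$ and suppose that at least one of the following holds: (i) $(\xi,\nu)$ arises from the variational construction: $(\xi,\nu)=K(\xi_0,\nu_0)$ for some $K>0$ and some minimizer $(\xi_0,\nu_0)$ of $E$ over $\{(f,g)\in H^1(\mathbb R)\times H^1(\mathbb R): F(f,g)=\lambda\}$, for some $\lambda>0$; (ii) $(\xi,\nu)$ is an arbitrary $H^1$ solution, and the quadratic form $E$ has a positive definite symbol, that is, for all $\theta\in\mathbb R$, $$\omega^2(1+\mu b\theta^2)^2<(1-\gamma)(1-\mu c\,\theta^2)\Big(\frac1\gamma-\frac{\sqrt\mu}{\gamma^2}|\theta|-\frac\mu\gamma\Big(a-\frac1{\gamma^2}\Big)\theta^2\Big).$$ Then $\xi,\nu\in H^\infty(\mathbb R)=\bigcap_{s}H^s(\mathbb R)$, and there is a constant $D\in\mathbb R$ such that for all $x\in\mathbb R$ $$x^2|\xi(x)|\le D\qquad\text{and}\qquad x^2|\nu(x)|\le D .$$ -/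

import Mathlib

open MeasureTheory
open scoped FourierTransform SchwartzMap

/-! The Boussinesq-Full dispersion solitary wave system with a lower layer of infinite depth. -/

namespace BFD

noncomputable section

/-- A real function on the line, regarded as complex valued. -/
def cplx (f : ℝ → ℝ) : ℝ → ℂ := fun x => (f x : ℂ)

/-- `f ∈ H^s(ℝ)`, for a square integrable real function `f` (used for `s ≥ 0`): the tempered
distribution defined by `f` lies in the Sobolev space of order `s` based on `L²`. -/
def MemHs (s : ℝ) (f : ℝ → ℝ) : Prop :=
  ∃ h : MemLp (cplx f) 2 volume,
    TemperedDistribution.MemSobolev s 2 (Lp.toTemperedDistribution (h.toLp (cplx f)))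

/-- `f ∈ H^∞(ℝ) = ⋂ₛ H^s(ℝ)`. -/
def MemHInfty (f : ℝ → ℝ) : Prop := ∀ s : ℝ, MemHs s f

open Classical in
/-- The (Plancherel) Fourier transform of `f ∈ L²(ℝ)`, normalized as the extension of
`y ↦ ∫ exp (-2πi x y) f x dx`; it is the zero function if `f` is not in `L²(ℝ)`. -/
def fourierL2 (f : ℝ → ℝ) : ℝ → ℂ :=
  if h : MemLp (cplx f) 2 volume then
    ((𝓕 (h.toLp (cplx f)) : Lp ℂ 2 (volume : Measure ℝ)) : ℝ → ℂ)
  else 0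

/-- Symbol, at the angular frequency `θ`, of `J_b = 1 - μ b ∂ₓ²`. -/
def symJb (μ b θ : ℝ) : ℝ := 1 + μ * b * θ ^ 2

/-- Symbol, at the angular frequency `θ`, of `J_c = 1 + μ c ∂ₓ²`. -/
def symJc (μ c θ : ℝ) : ℝ := 1 - μ * c * θ ^ 2

/-- Symbol, at the angular frequency `θ`, of
`L = 1/γ - (√μ/γ²) |D| + (μ/γ) (a - 1/γ²) ∂ₓ²`. -/
def symL (γ μ a θ : ℝ) : ℝ :=
  1 / γ - Real.sqrt μ / γ ^ 2 * |θ| - μ / γ * (a - 1 / γ ^ 2) * θ ^ 2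

/-- `(ξ, ν)`, in `H¹(ℝ) × H¹(ℝ)`, solves the solitary wave system
`-ω J_b ξ + L ν = (ε/γ) ξ ν`, `-ω J_b ν + (1 - γ) J_c ξ = (ε/(2γ)) ν²`.
Both equations hold between tempered distributions, that is, between the Fourier transforms
of the two sides; these are functions since `ξ, ν, ξν, ν² ∈ L²(ℝ)`. The angular frequency
belonging to the variable `y` of `fourierL2` is `2πy`. -/
structure IsSolitaryWave (γ ε μ a b c ω : ℝ) (ξ ν : ℝ → ℝ) : Prop where
  memH1_fst : MemHs 1 ξ
  memH1_snd : MemHs 1 ν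
  eq_fst : ∀ᵐ y : ℝ,
    -(ω : ℂ) * (symJb μ b (2 * Real.pi * y) : ℂ) * fourierL2 ξ y
        + (symL γ μ a (2 * Real.pi * y) : ℂ) * fourierL2 ν y
      = ((ε / γ : ℝ) : ℂ) * fourierL2 (fun x => ξ x * ν x) y
  eq_snd : ∀ᵐ y : ℝ,
    -(ω : ℂ) * (symJb μ b (2 * Real.pi * y) : ℂ) * fourierL2 ν y
        + ((1 - γ : ℝ) : ℂ) * (symJc μ c (2 * Real.pi * y) : ℂ) * fourierL2 ξ y
      = ((ε / (2 * γ) : ℝ) : ℂ) * fourierL2 (fun x => ν x ^ 2) y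

/-- The functional `E(ξ, ν) = ∫ ((1-γ)/2) ξ J_c ξ + (1/2) ν L ν - ω ξ J_b ν dx` on
`H¹(ℝ) × H¹(ℝ)`, where the integrals are the `H¹`-`H⁻¹` pairings, written on the Fourier side. -/
def energyE (γ μ a b c ω : ℝ) (ξ ν : ℝ → ℝ) : ℝ :=
  ∫ y : ℝ, ((1 - γ) / 2 * symJc μ c (2 * Real.pi * y) * ‖fourierL2 ξ y‖ ^ 2
    + 1 / 2 * symL γ μ a (2 * Real.pi * y) * ‖fourierL2 ν y‖ ^ 2
    - ω * symJb μ b (2 * Real.pi * y)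
        * (fourierL2 ξ y * (starRingEnd ℂ) (fourierL2 ν y)).re)

/-- The constraint functional `F(ξ, ν) = (ε/(2γ)) ∫ ξ ν² dx`. -/
def constraintF (γ ε : ℝ) (ξ ν : ℝ → ℝ) : ℝ :=
  ε / (2 * γ) * ∫ x : ℝ, ξ x * ν x ^ 2

/-- `(ξ, ν)` is a minimizer of `E` over the pairs in `H¹(ℝ) × H¹(ℝ)` with `F = lam`. -/
structure IsConstrainedMinimizer (γ ε μ a b c ω lam : ℝ) (ξ ν : ℝ → ℝ) : Prop where
  memH1_fst : MemHs 1 ξ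
  memH1_snd : MemHs 1 ν
  constraint : constraintF γ ε ξ ν = lam
  minimal : ∀ ξ' ν' : ℝ → ℝ, MemHs 1 ξ' → MemHs 1 ν' → constraintF γ ε ξ' ν' = lam →
    energyE γ μ a b c ω ξ ν ≤ energyE γ μ a b c ω ξ' ν'

/-- The quadratic form `E` has a positive definite symbol at every frequency (its diagonal
entry belonging to `J_c` is positive when `γ < 1`, `μ ≥ 0`, `c ≤ 0`, so this is positivity of
the determinant). -/
def SymbolPosDef (γ μ a b c ω : ℝ) : Prop :=
  ∀ θ : ℝ, (ω * symJb μ b θ) ^ 2 < (1 - γ) * symJc μ c θ * symL γ μ a θ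

end

end BFD

/-!
Solitary waves are `C^∞` in the Sobolev sense and decay quadratically.

On the Fourier side the linear part is, at each frequency `θ`, a symmetric `2 × 2` matrix whose
determinant `Δ` is a quartic polynomial in `|θ|`. If `Δ > 0` everywhere, then `Δ` has degree exactly
four, because its cubic coefficient is negative, and the matrix can be inverted:
`ξ = K₁ * (ξν) + K₂ * ν²` and `ν = K₃ * (ξν) + K₄ * ν²`, where each `Kᵢ` has a symbol `P(|θ|) / Δ`
with `P` quadratic.

* Regularity. These symbols are `O((1 + θ²)⁻¹)`, and the Fourier transform of a product is the
  convolution of the Fourier transforms. As `L¹` with the weight `(1 + |y|) ^ k` is a convolution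
  algebra, the Fourier transforms of `ξ` and `ν` gain a power of the weight at each step.
* Decay. Two integrations by parts on the half line give `|Kᵢ(x)| ≤ C / (1 + x²)`
  (`exists_norm_fourier_eval_div_le`); the kink of the symbols at `θ = 0` is what limits the rate.
  So `U = |ξ| + |ν|` is dominated by the convolution of `U²` with `1 / (1 + x²)`, and since `U` tends
  to zero at infinity, `exists_le_inv_one_add_sq` gives `U ≤ D / (1 + x²)`.

It remains to see that a constrained minimizer at a positive level can exist only if `Δ > 0`
everywhere (`IsConstrainedMinimizer.symbolPosDef`). Suppose `Δ(θ₀) ≤ 0`. Let `u` be a Gaussian of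
width `R` and `w = u sin(θ₀ x)`. The pair `(α A w + q u, A w)` has `F` proportional to
`A² q ∫ u w²`, so the constraint fixes `q`, of size `1 / (A² R)`. By parity its energy splits; the
part of `(α A w, A w)`, with `α` chosen to minimize the form at `θ₀`, is at most
`A² (κ Δ(θ₀) R + K)` with some `κ > 0`, and that of `(q u, 0)` is `O(1 / (A⁴ R))`. Letting
`R → ∞` and then `A → 0` shows that `Δ(θ₀) < 0` is impossible, and that `Δ(θ₀) = 0` makes the
minimum at most zero. In the latter case the energy density is nonnegative, so it vanishes almost
everywhere, and then so does the second component, because `Δ` has finitely many zeros; this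
contradicts the constraint.
-/

/-! ### The Fourier transform on `L²` and the Sobolev spaces -/

namespace BFD

section

open TemperedDistribution

theorem ae_eq_of_integral_schwartz_mul_eq {f g : ℝ → ℂ} (hf : LocallyIntegrable f)
    (hg : LocallyIntegrable g)
    (h : ∀ φ : 𝓢(ℝ, ℂ), ∫ x, φ x * f x = ∫ x, φ x * g x) : f =ᵐ[volume] g := by
  refine ae_eq_of_integral_contDiff_smul_eq hf hg fun φ hφ hφc => ?_
  have hc : HasCompactSupport (fun x => (φ x : ℂ)) := hφc.comp_left (g := ((↑) : ℝ → ℂ)) rfl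
  have hs : ContDiff ℝ (↑(⊤ : ℕ∞)) (fun x => (φ x : ℂ)) := Complex.ofRealCLM.contDiff.comp hφ
  simpa [Complex.real_smul] using h (hc.toSchwartzMap hs)

theorem integral_schwartz_mul_fourier (φ : 𝓢(ℝ, ℂ)) {f : ℝ → ℂ} (hf : Integrable f) :
    ∫ x, (𝓕 φ) x * f x = ∫ x, φ x * 𝓕 f x := by
  have h := VectorFourier.integral_fourierIntegral_smul_eq_flip (μ := volume) (ν := volume)
    (L := innerₗ ℝ) (f := (φ : ℝ → ℂ)) (g := f) Real.continuous_fourierChar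
    continuous_inner φ.integrable hf
  simp only [smul_eq_mul, flip_innerₗ] at h
  rw [SchwartzMap.fourier_coe]; exact h

theorem integral_schwartz_mul_fourierInv (φ : 𝓢(ℝ, ℂ)) {f : ℝ → ℂ} (hf : Integrable f) :
    ∫ x, (𝓕⁻ φ) x * f x = ∫ x, φ x * 𝓕⁻ f x := by
  have h := VectorFourier.integral_fourierIntegral_smul_eq_flip (μ := volume) (ν := volume)
    (L := -innerₗ ℝ) (f := (φ : ℝ → ℂ)) (g := f) Real.continuous_fourierChar
    (by exact continuous_inner.neg) φ.integrable hf
  have e : (-innerₗ ℝ).flip = -innerₗ ℝ := by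
    ext; simp
  simp only [smul_eq_mul, e] at h
  rw [SchwartzMap.fourierInv_coe]; exact h

theorem continuous_fourier {f : ℝ → ℂ} (hf : Integrable f) : Continuous (𝓕 f) :=
  VectorFourier.fourierIntegral_continuous Real.continuous_fourierChar
    (by exact continuous_inner) hf

theorem continuous_fourierInv {f : ℝ → ℂ} (hf : Integrable f) : Continuous (𝓕⁻ f) :=
  VectorFourier.fourierIntegral_continuous (L := -innerₗ ℝ) Real.continuous_fourierChar
    (by exact continuous_inner.neg) hf

theorem norm_fourier_le (f : ℝ → ℂ) (y : ℝ) : ‖𝓕 f y‖ ≤ ∫ x, ‖f x‖ :=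
  VectorFourier.norm_fourierIntegral_le_integral_norm _ _ _ _ _

theorem norm_fourierInv_le (f : ℝ → ℂ) (y : ℝ) : ‖𝓕⁻ f y‖ ≤ ∫ x, ‖f x‖ :=
  VectorFourier.norm_fourierIntegral_le_integral_norm _ _ _ _ _

theorem locallyIntegrable_lp (f : Lp ℂ 2 (volume : Measure ℝ)) : LocallyIntegrable f :=
  (Lp.memLp f).locallyIntegrable (by norm_num)

/-- On `L¹ ∩ L²` the Plancherel transform is the Fourier integral. -/
theorem fourier_toLp_ae_eq {f : ℝ → ℂ} (hf : Integrable f) (hf2 : MemLp f 2 volume) :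
    (𝓕 (hf2.toLp f) : Lp ℂ 2 (volume : Measure ℝ)) =ᵐ[volume] 𝓕 f := by
  refine ae_eq_of_integral_schwartz_mul_eq (locallyIntegrable_lp _)
    (continuous_fourier hf).locallyIntegrable fun φ => ?_
  have h := DFunLike.congr_fun (Lp.fourier_toTemperedDistribution_eq (hf2.toLp f)) φ
  rw [TemperedDistribution.fourier_apply, Lp.toTemperedDistribution_apply,
    Lp.toTemperedDistribution_apply] at h
  simp only [smul_eq_mul] at h
  rw [← h, ← integral_schwartz_mul_fourier φ hf]
  refine integral_congr_ae ?_
  filter_upwards [hf2.coeFn_toLp] with x hx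
  rw [hx]

theorem fourierInv_lp_ae_eq (g : Lp ℂ 2 (volume : Measure ℝ)) (hg : Integrable g) :
    (𝓕⁻ g : Lp ℂ 2 (volume : Measure ℝ)) =ᵐ[volume] 𝓕⁻ (g : ℝ → ℂ) := by
  refine ae_eq_of_integral_schwartz_mul_eq (locallyIntegrable_lp _)
    (continuous_fourierInv hg).locallyIntegrable fun φ => ?_
  have h := DFunLike.congr_fun (Lp.fourierInv_toTemperedDistribution_eq g) φ
  rw [TemperedDistribution.fourierInv_apply, Lp.toTemperedDistribution_apply,
    Lp.toTemperedDistribution_apply] at h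
  simp only [smul_eq_mul] at h
  rw [← h, ← integral_schwartz_mul_fourierInv φ hg]

theorem fourierL2_eq {f : ℝ → ℝ} (h : MemLp (cplx f) 2 volume) :
    fourierL2 f = ((𝓕 (h.toLp (cplx f)) : Lp ℂ 2 (volume : Measure ℝ)) : ℝ → ℂ) := by
  simp [fourierL2, h]

theorem memLp_fourierL2 (f : ℝ → ℝ) : MemLp (fourierL2 f) 2 volume := by
  by_cases h : MemLp (cplx f) 2 volume
  · rw [fourierL2_eq h]; exact Lp.memLp _
  · simp [fourierL2, h]

theorem fourierL2_ae_eq {f : ℝ → ℝ} (hf : Integrable (cplx f)) (hf2 : MemLp (cplx f) 2 volume) :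
    fourierL2 f =ᵐ[volume] 𝓕 (cplx f) := by
  rw [fourierL2_eq hf2]; exact fourier_toLp_ae_eq hf hf2

theorem cplx_ae_eq_fourierInv {f : ℝ → ℝ} (h : MemLp (cplx f) 2 volume)
    (hi : Integrable (fourierL2 f)) : cplx f =ᵐ[volume] 𝓕⁻ (fourierL2 f) := by
  rw [fourierL2_eq h] at hi ⊢
  have h1 := fourierInv_lp_ae_eq _ hi
  rw [FourierTransform.fourierInv_fourier_eq] at h1
  exact h.coeFn_toLp.symm.trans h1

/-- Plancherel's identity. -/
theorem integral_norm_fourierL2_sq {f : ℝ → ℝ} (h : MemLp (cplx f) 2 volume) :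
    ∫ y, ‖fourierL2 f y‖ ^ 2 = ∫ x, f x ^ 2 := by
  have key : ∀ g : Lp ℂ 2 (volume : Measure ℝ), ∫ x, ‖g x‖ ^ 2 = ‖g‖ ^ 2 := by
    intro g
    have := L2.inner_def (𝕜 := ℂ) g g
    rw [inner_self_eq_norm_sq_to_K] at this
    have h2 : ∀ x, inner ℂ (g x) (g x) = ((‖g x‖ ^ 2 : ℝ) : ℂ) := by
      intro x; rw [inner_self_eq_norm_sq_to_K]; norm_cast
    simp only [h2] at this
    have h3 := integral_ofReal (𝕜 := ℂ) (μ := volume) (f := fun x => ‖g x‖ ^ 2)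
    exact_mod_cast (this.trans h3).symm
  rw [fourierL2_eq h, key, Lp.norm_fourier_eq, ← key]
  refine integral_congr_ae ?_
  filter_upwards [h.coeFn_toLp] with x hx
  rw [hx]; simp [cplx]

/-- `f ∈ H^s` if and only if `f ∈ L²` and `(1 + y²)^{s/2} f̂ ∈ L²`. -/
theorem memHs_iff {s : ℝ} {f : ℝ → ℝ} : MemHs s f ↔ MemLp (cplx f) 2 volume ∧
    MemLp (fun y => (((1 + y ^ 2) ^ (s / 2) : ℝ) : ℂ) * fourierL2 f y) 2 volume := by
  have hw : (fun y : ℝ => (((1 + ‖y‖ ^ 2) ^ (s / 2) : ℝ) : ℂ)).HasTemperateGrowth := by fun_prop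
  have hwc : Continuous (fun y : ℝ => (((1 + y ^ 2) ^ (s / 2) : ℝ) : ℂ)) := by
    have := hw.1.continuous
    simpa using this
  have key : ∀ (h : MemLp (cplx f) 2 volume) (f' : Lp ℂ 2 (volume : Measure ℝ)),
      smulLeftCLM ℂ (fun x : ℝ ↦ (((1 + ‖x‖ ^ 2) ^ (s / 2) : ℝ) : ℂ))
        (𝓕 (Lp.toTemperedDistribution (h.toLp (cplx f)))) = Lp.toTemperedDistribution f' ↔
      (fun y => (((1 + y ^ 2) ^ (s / 2) : ℝ) : ℂ) * fourierL2 f y) =ᵐ[volume] f' := by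
    intro h f'
    have hl : ∀ φ : 𝓢(ℝ, ℂ), smulLeftCLM ℂ (fun x : ℝ ↦ (((1 + ‖x‖ ^ 2) ^ (s / 2) : ℝ) : ℂ))
        (𝓕 (Lp.toTemperedDistribution (h.toLp (cplx f)))) φ =
        ∫ y, φ y * ((((1 + y ^ 2) ^ (s / 2) : ℝ) : ℂ) * fourierL2 f y) := by
      intro φ
      rw [Lp.fourier_toTemperedDistribution_eq, smulLeftCLM_apply_apply,
        Lp.toTemperedDistribution_apply, ← fourierL2_eq h]
      refine integral_congr_ae (.of_forall fun y => ?_)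
      have := SchwartzMap.smulLeftCLM_apply_apply (F := ℂ) hw φ y
      beta_reduce
      rw [this]
      simp only [smul_eq_mul, Real.norm_eq_abs, sq_abs]
      ring
    constructor
    · intro he
      refine ae_eq_of_integral_schwartz_mul_eq ?_ (locallyIntegrable_lp _) fun φ => ?_
      · have := ((memLp_fourierL2 f).locallyIntegrable (by norm_num)).locallyIntegrableOn Set.univ
        rw [← locallyIntegrableOn_univ]
        exact this.continuousOn_mul hwc.continuousOn isOpen_univ.isLocallyClosed
      · rw [← hl, he, Lp.toTemperedDistribution_apply]; simp
    · intro he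
      ext φ
      rw [hl, Lp.toTemperedDistribution_apply]
      refine integral_congr_ae ?_
      filter_upwards [he] with y hy
      rw [hy, smul_eq_mul]
  unfold MemHs
  constructor
  · rintro ⟨h, hs⟩
    refine ⟨h, ?_⟩
    obtain ⟨f', hf'⟩ := memSobolev_iff_exists_smulLeftCLM_fourier.mp hs
    exact (memLp_congr_ae ((key h f').1 hf')).2 (Lp.memLp f')
  · rintro ⟨h, hs⟩
    refine ⟨h, memSobolev_iff_exists_smulLeftCLM_fourier.mpr ⟨hs.toLp _, ?_⟩⟩
    exact (key h _).2 hs.coeFn_toLp.symm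

end

end BFD

/-! ### Decay from a quadratic convolution inequality -/

namespace BFD

section

open Filter Topology

theorem integrable_inv_one_add_sub_sq (x : ℝ) : Integrable fun z : ℝ => (1 + (x - z) ^ 2)⁻¹ :=
  integrable_inv_one_add_sq.comp_sub_left x

theorem inv_one_add_sq_mul_le (x z : ℝ) : (1 + (x - z) ^ 2)⁻¹ * (1 + z ^ 2)⁻¹ ≤
    2 * (1 + x ^ 2)⁻¹ * ((1 + z ^ 2)⁻¹ + (1 + (x - z) ^ 2)⁻¹) := by
  have e : (1 + z ^ 2)⁻¹ + (1 + (x - z) ^ 2)⁻¹ = ((1 + (x - z) ^ 2) + (1 + z ^ 2)) *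
      ((1 + (x - z) ^ 2)⁻¹ * (1 + z ^ 2)⁻¹) := by
    have : 1 + (x - z) ^ 2 ≠ 0 := by positivity
    field_simp
  rw [e, ← mul_assoc]
  refine le_mul_of_one_le_left (by positivity) ?_
  rw [mul_assoc, ← div_eq_inv_mul, ← mul_div_assoc, le_div_iff₀ (by positivity)]
  nlinarith [sq_nonneg (x - z - z)]

theorem integrable_inv_one_add_sq_conv (x : ℝ) :
    Integrable fun z : ℝ => (1 + (x - z) ^ 2)⁻¹ * (1 + z ^ 2)⁻¹ := by
  refine (integrable_inv_one_add_sub_sq x).mono' (by fun_prop) (.of_forall fun z => ?_)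
  rw [Real.norm_of_nonneg (by positivity)]
  exact mul_le_of_le_one_right (by positivity) (inv_le_one_of_one_le₀ (by nlinarith [sq_nonneg z]))

theorem integral_inv_one_add_sq_conv_le (x : ℝ) :
    ∫ z : ℝ, (1 + (x - z) ^ 2)⁻¹ * (1 + z ^ 2)⁻¹ ≤ 4 * Real.pi * (1 + x ^ 2)⁻¹ := by
  have h1 := integrable_inv_one_add_sub_sq x
  calc _ ≤ ∫ z : ℝ, 2 * (1 + x ^ 2)⁻¹ * ((1 + z ^ 2)⁻¹ + (1 + (x - z) ^ 2)⁻¹) :=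
        integral_mono (integrable_inv_one_add_sq_conv x)
          ((integrable_inv_one_add_sq.add h1).const_mul _) (inv_one_add_sq_mul_le x)
    _ = _ := by
        rw [integral_const_mul, integral_add integrable_inv_one_add_sq h1,
          integral_sub_left_eq_self (fun z : ℝ => (1 + z ^ 2)⁻¹), integral_univ_inv_one_add_sq]
        ring

/-- A bounded function vanishing at infinity which is dominated by the convolution of its own
square with `1 / (1 + x²)` decays as fast as that kernel. The weights `1 / (1 + x²) + δ` make the
best constant finite a priori; the smallness of the function at infinity lets it be absorbed, and
the resulting bound does not depend on `δ`. -/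
theorem exists_le_inv_one_add_sq {U : ℝ → ℝ} {B C : ℝ} (hC : 0 < C)
    (h0 : ∀ x, 0 ≤ U x) (hB : ∀ x, U x ≤ B) (hlim : Tendsto U (cocompact ℝ) (𝓝 0))
    (h : ∀ x, U x ≤ C * ∫ z, (1 + (x - z) ^ 2)⁻¹ * U z ^ 2) :
    ∃ D, ∀ x, U x ≤ D * (1 + x ^ 2)⁻¹ := by
  have hpi := Real.pi_pos
  have hB0 : 0 ≤ B := (h0 0).trans (hB 0)
  set σ : ℝ := 1 / (8 * Real.pi * C) with hσ
  have hσ0 : 0 < σ := by positivity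
  obtain ⟨R, hR⟩ : ∃ R : ℝ, ∀ z, R ≤ |z| → U z ≤ σ := by
    have h1 : ∀ᶠ z in cocompact ℝ, U z < σ := hlim.eventually (gt_mem_nhds hσ0)
    rw [← Metric.cobounded_eq_cocompact, ← comap_norm_atTop, eventually_comap] at h1
    obtain ⟨R, hR⟩ := eventually_atTop.1 h1
    exact ⟨R, fun z hz => (hR _ hz z rfl).le⟩
  set A : ℝ := C * (4 * Real.pi) * (B ^ 2 * (1 + R ^ 2)) with hA
  have hk : ∀ z : ℝ, 0 < (1 + z ^ 2)⁻¹ := fun z => by positivity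
  have main : ∀ δ > 0, ∀ x, U x ≤ 2 * A * ((1 + x ^ 2)⁻¹ + δ) := by
    intro δ hδ
    have hv : ∀ x : ℝ, 0 < (1 + x ^ 2)⁻¹ + δ := fun x => by positivity
    have hbdd : BddAbove (Set.range fun x => U x / ((1 + x ^ 2)⁻¹ + δ)) := by
      refine ⟨B / δ, ?_⟩
      rintro _ ⟨x, rfl⟩
      exact div_le_div₀ hB0 (hB x) hδ (by linarith [hk x])
    set M := ⨆ x, U x / ((1 + x ^ 2)⁻¹ + δ) with hM
    -- The weight is at least `δ`, so this supremum is finite.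
    have hUM : ∀ x, U x ≤ M * ((1 + x ^ 2)⁻¹ + δ) := fun x =>
      (div_le_iff₀ (hv x)).1 (le_ciSup hbdd x)
    have hM0 : 0 ≤ M := (div_nonneg (h0 0) (hv 0).le).trans (le_ciSup hbdd 0)
    have hsq : ∀ z, U z ^ 2 ≤ (B ^ 2 * (1 + R ^ 2) + σ * M) * (1 + z ^ 2)⁻¹ + σ * M * δ := by
      intro z
      have e1 : 0 ≤ σ * M * ((1 + z ^ 2)⁻¹ + δ) := by have := hv z; positivity
      have e2 : 0 ≤ B ^ 2 * (1 + R ^ 2) * (1 + z ^ 2)⁻¹ := by positivity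
      rcases le_total R |z| with hz | hz
      · have : U z ^ 2 ≤ σ * (M * ((1 + z ^ 2)⁻¹ + δ)) := by
          rw [sq]; exact mul_le_mul (hR z hz) (hUM z) (h0 z) hσ0.le
        nlinarith
      · have h1 : U z ^ 2 ≤ B ^ 2 := pow_le_pow_left₀ (h0 z) (hB z) 2
        have h2 : B ^ 2 ≤ B ^ 2 * (1 + R ^ 2) * (1 + z ^ 2)⁻¹ := by
          rw [mul_assoc]
          refine le_mul_of_one_le_right (by positivity) ?_
          rw [← div_eq_mul_inv, one_le_div (by positivity)]
          have := pow_le_pow_left₀ (abs_nonneg z) hz 2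
          rw [sq_abs] at this
          linarith
        nlinarith
    have hstep : ∀ x, U x ≤ (A + M / 2) * ((1 + x ^ 2)⁻¹ + δ) := by
      intro x
      have hi1 := integrable_inv_one_add_sq_conv x
      have hi2 := integrable_inv_one_add_sub_sq x
      have hint : ∫ z, (1 + (x - z) ^ 2)⁻¹ * U z ^ 2 ≤
          (B ^ 2 * (1 + R ^ 2) + σ * M) * (4 * Real.pi * (1 + x ^ 2)⁻¹)
            + σ * M * δ * Real.pi := by
        calc _ ≤ ∫ z, ((B ^ 2 * (1 + R ^ 2) + σ * M) * ((1 + (x - z) ^ 2)⁻¹ * (1 + z ^ 2)⁻¹)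
              + σ * M * δ * (1 + (x - z) ^ 2)⁻¹) := by
              refine integral_mono_of_nonneg (.of_forall fun z => by positivity)
                ((hi1.const_mul _).add (hi2.const_mul _)) (.of_forall fun z => ?_)
              have := mul_le_mul_of_nonneg_left (hsq z) (hk (x - z)).le
              simp only at this ⊢
              linarith
          _ = (B ^ 2 * (1 + R ^ 2) + σ * M) * (∫ z, (1 + (x - z) ^ 2)⁻¹ * (1 + z ^ 2)⁻¹)
              + σ * M * δ * Real.pi := by
              rw [integral_add (hi1.const_mul _) (hi2.const_mul _), integral_const_mul,
                integral_const_mul, integral_sub_left_eq_self (fun z : ℝ => (1 + z ^ 2)⁻¹),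
                integral_univ_inv_one_add_sq]
          _ ≤ _ := by
              gcongr
              exact integral_inv_one_add_sq_conv_le x
      have h1 := (h x).trans (mul_le_mul_of_nonneg_left hint hC.le)
      have e : C * σ * Real.pi = 1 / 8 := by rw [hσ]; field_simp
      have hx := hk x
      have : C * ((B ^ 2 * (1 + R ^ 2) + σ * M) * (4 * Real.pi * (1 + x ^ 2)⁻¹)
            + σ * M * δ * Real.pi) = A * (1 + x ^ 2)⁻¹
            + (C * σ * Real.pi) * (4 * M * (1 + x ^ 2)⁻¹ + M * δ) := by rw [hA]; ring
      rw [this, e] at h1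
      have hA0 : 0 ≤ A := by positivity
      have := mul_nonneg hA0 hδ.le
      have := mul_nonneg hM0 hδ.le
      nlinarith
    have hMle : M ≤ A + M / 2 := ciSup_le fun x => (div_le_iff₀ (hv x)).2 (hstep x)
    intro x
    exact (hUM x).trans (mul_le_mul_of_nonneg_right (by linarith) (hv x).le)
  refine ⟨2 * A, fun x => ?_⟩
  have ht : Tendsto (fun δ : ℝ => 2 * A * ((1 + x ^ 2)⁻¹ + δ)) (𝓝[>] 0)
      (𝓝 (2 * A * ((1 + x ^ 2)⁻¹ + 0))) := by
    refine Tendsto.mono_left ?_ nhdsWithin_le_nhds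
    exact (continuous_const.mul (continuous_const.add continuous_id)).tendsto 0
  rw [add_zero] at ht
  exact ge_of_tendsto ht (eventually_mem_nhdsWithin.mono fun δ hδ => main δ hδ x)

end

end BFD

/-! ### Kernels with rational symbols in `|y|` -/

namespace BFD

section

open Filter Topology Polynomial

theorem exists_abs_eval_le {P Q : ℝ[X]} (hdeg : P.degree ≤ Q.degree)
    (hQ : ∀ t : ℝ, 0 ≤ t → 0 < Q.eval t) :
    ∃ C, 0 < C ∧ ∀ t : ℝ, 0 ≤ t → |P.eval t| ≤ C * Q.eval t := by
  obtain ⟨C, hC⟩ := (Polynomial.isBigO_atTop_of_degree_le P Q hdeg).bound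
  obtain ⟨T, hT⟩ := eventually_atTop.1 hC
  have hc : ContinuousOn (fun t => |P.eval t| / Q.eval t) (Set.Icc 0 T) :=
    ContinuousOn.div (by fun_prop) (by fun_prop) fun t ht => (hQ t ht.1).ne'
  obtain ⟨B, hB⟩ := isCompact_Icc.exists_bound_of_continuousOn hc
  refine ⟨|C| + |B| + 1, by positivity, fun t ht => ?_⟩
  have hq := hQ t ht
  rcases le_total T t with h | h
  · have := hT t h
    rw [Real.norm_eq_abs, Real.norm_eq_abs, abs_of_pos hq] at this
    refine this.trans (mul_le_mul_of_nonneg_right ?_ hq.le)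
    linarith [le_abs_self C, abs_nonneg B]
  · have := hB t ⟨ht, h⟩
    rw [Real.norm_of_nonneg (by positivity), div_le_iff₀ hq] at this
    refine this.trans (mul_le_mul_of_nonneg_right ?_ hq.le)
    linarith [le_abs_self B, abs_nonneg C]

theorem exists_abs_eval_div_le {P Q : ℝ[X]} (hdeg : P.natDegree + 2 ≤ Q.natDegree)
    (hQ : ∀ t : ℝ, 0 ≤ t → 0 < Q.eval t) :
    ∃ C, 0 < C ∧ ∀ t : ℝ, 0 ≤ t → |P.eval t / Q.eval t| ≤ C * (1 + t ^ 2)⁻¹ := by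
  have hQ0 : Q ≠ 0 := by rintro rfl; simpa using hQ 0 le_rfl
  have hd : (P * (1 + X ^ 2)).degree ≤ Q.degree := by
    rw [degree_eq_natDegree hQ0]
    refine degree_le_of_natDegree_le (natDegree_mul_le.trans ?_)
    have : (1 + X ^ 2 : ℝ[X]).natDegree ≤ 2 := by compute_degree
    omega
  obtain ⟨C, hC, h⟩ := exists_abs_eval_le hd hQ
  refine ⟨C, hC, fun t ht => ?_⟩
  have h1 := h t ht
  have hw : 0 < 1 + t ^ 2 := by positivity
  rw [abs_div, abs_of_pos (hQ t ht), div_le_iff₀ (hQ t ht)]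
  simp only [eval_mul, eval_add, eval_one, eval_pow, eval_X, abs_mul, abs_of_pos hw] at h1
  rw [← le_div_iff₀ hw] at h1
  refine h1.trans_eq ?_
  field_simp

theorem hasDerivAt_eval_div (P Q : ℝ[X]) {t : ℝ} (h : Q.eval t ≠ 0) :
    HasDerivAt (fun t => P.eval t / Q.eval t)
      ((derivative P * Q - P * derivative Q).eval t / (Q ^ 2).eval t) t := by
  have := (P.hasDerivAt t).div (Q.hasDerivAt t) h
  simpa [Pi.div_def] using this

theorem natDegree_derivative_numerator_le {P Q : ℝ[X]} (hdeg : P.natDegree + 2 ≤ Q.natDegree) :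
    (derivative P * Q - P * derivative Q).natDegree + 2 ≤ (Q ^ 2).natDegree := by
  have h1 : (derivative P * Q).natDegree ≤ P.natDegree + Q.natDegree :=
    natDegree_mul_le.trans (by have := natDegree_derivative_le P; omega)
  have h2 : (P * derivative Q).natDegree ≤ P.natDegree + Q.natDegree :=
    natDegree_mul_le.trans (by have := natDegree_derivative_le Q; omega)
  have := natDegree_sub_le_of_le h1 h2
  rw [natDegree_pow]
  simp only [max_self] at this
  omega

theorem integrable_of_le_inv_one_add_sq {f : ℝ → ℝ} {C : ℝ} (hf : ContinuousOn f (Set.Ici 0))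
    (h : ∀ t : ℝ, 0 ≤ t → |f t| ≤ C * (1 + t ^ 2)⁻¹) : IntegrableOn f (Set.Ioi 0) := by
  refine Integrable.mono' (integrable_inv_one_add_sq.const_mul C).integrableOn
    ((hf.mono Set.Ioi_subset_Ici_self).aestronglyMeasurable measurableSet_Ioi) ?_
  exact (ae_restrict_mem measurableSet_Ioi).mono fun t ht => h t (le_of_lt ht)

theorem tendsto_of_le_inv_one_add_sq {f : ℝ → ℝ} {C : ℝ}
    (h : ∀ t : ℝ, 0 ≤ t → |f t| ≤ C * (1 + t ^ 2)⁻¹) : Tendsto f atTop (𝓝 0) := by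
  have h1 : Tendsto (fun t : ℝ => 1 + t ^ 2) atTop atTop :=
    tendsto_atTop_add_const_left _ _ (tendsto_pow_atTop two_ne_zero)
  have h2 : Tendsto (fun t : ℝ => C * (1 + t ^ 2)⁻¹) atTop (𝓝 0) := by
    simpa using h1.inv_tendsto_atTop.const_mul C
  exact squeeze_zero_norm' ((eventually_ge_atTop 0).mono fun t ht => h t ht) h2

/-- Decay of the cosine transform of a function on the half line: after two integrations by
parts the boundary terms are those of `ρ'` at `0`. -/
theorem abs_integral_cos_mul_le {ρ ρ' ρ'' : ℝ → ℝ} {C C' C'' : ℝ}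
    (h1 : ∀ t, 0 ≤ t → HasDerivAt ρ (ρ' t) t) (h2 : ∀ t, 0 ≤ t → HasDerivAt ρ' (ρ'' t) t)
    (hc : ContinuousOn ρ'' (Set.Ici 0))
    (hb : ∀ t : ℝ, 0 ≤ t → |ρ t| ≤ C * (1 + t ^ 2)⁻¹)
    (hb' : ∀ t : ℝ, 0 ≤ t → |ρ' t| ≤ C' * (1 + t ^ 2)⁻¹)
    (hb'' : ∀ t : ℝ, 0 ≤ t → |ρ'' t| ≤ C'' * (1 + t ^ 2)⁻¹) :
    ∃ D, ∀ w : ℝ, |∫ t in Set.Ioi 0, Real.cos (w * t) * ρ t| ≤ D * (1 + w ^ 2)⁻¹ := by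
  have hρc : ContinuousOn ρ (Set.Ici 0) := fun t ht => (h1 t ht).continuousAt.continuousWithinAt
  have hi := integrable_of_le_inv_one_add_sq hρc hb
  have hi'' := integrable_of_le_inv_one_add_sq hc hb''
  have hcos : ∀ (w : ℝ) {f : ℝ → ℝ}, IntegrableOn f (Set.Ioi 0) →
      IntegrableOn (fun t => Real.cos (w * t) * f t) (Set.Ioi 0) := fun w f hf =>
    hf.bdd_mul (c := 1) (by fun_prop)
      (.of_forall fun t => by simpa using Real.abs_cos_le_one _)
  have habs : ∀ (w : ℝ) {f : ℝ → ℝ}, IntegrableOn f (Set.Ioi 0) →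
      |∫ t in Set.Ioi 0, Real.cos (w * t) * f t| ≤ ∫ t in Set.Ioi 0, |f t| := fun w f hf => by
    refine (abs_integral_le_integral_abs).trans (integral_mono_of_nonneg
      (.of_forall fun t => abs_nonneg _) hf.abs (.of_forall fun t => ?_))
    simp only [abs_mul]
    exact mul_le_of_le_one_left (abs_nonneg _) (Real.abs_cos_le_one _)
  set A := ∫ t in Set.Ioi 0, |ρ t|
  set B := ∫ t in Set.Ioi 0, |ρ'' t|
  refine ⟨A + (|ρ' 0| + B), fun w => ?_⟩
  set J := ∫ t in Set.Ioi 0, Real.cos (w * t) * ρ t with hJ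
  have hJA : |J| ≤ A := habs w hi
  have hJB : |J| * w ^ 2 ≤ |ρ' 0| + B := by
    have ht1 := tendsto_of_le_inv_one_add_sq hb
    have ht2 := tendsto_of_le_inv_one_add_sq hb'
    have hlim : Tendsto (fun t => w * Real.sin (w * t) * ρ t + Real.cos (w * t) * ρ' t) atTop
        (𝓝 0) := by
      have e1 : Tendsto (fun t => w * Real.sin (w * t) * ρ t) atTop (𝓝 0) := by
        refine squeeze_zero_norm (a := fun t => |w| * |ρ t|) (fun t => ?_)
          (by simpa using ht1.abs.const_mul |w|)
        rw [Real.norm_eq_abs, abs_mul, abs_mul]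
        exact mul_le_mul_of_nonneg_right
          (mul_le_of_le_one_right (abs_nonneg _) (Real.abs_sin_le_one _)) (abs_nonneg _)
      have e2 : Tendsto (fun t => Real.cos (w * t) * ρ' t) atTop (𝓝 0) := by
        refine squeeze_zero_norm (a := fun t => |ρ' t|) (fun t => ?_) (by simpa using ht2.abs)
        rw [Real.norm_eq_abs, abs_mul]
        exact mul_le_of_le_one_left (abs_nonneg _) (Real.abs_cos_le_one _)
      simpa using e1.add e2
    have hd : ∀ t ∈ Set.Ici (0 : ℝ),
        HasDerivAt (fun t => w * Real.sin (w * t) * ρ t + Real.cos (w * t) * ρ' t)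
          (w ^ 2 * (Real.cos (w * t) * ρ t) + Real.cos (w * t) * ρ'' t) t := by
      intro t ht
      have hw : HasDerivAt (fun t => w * t) w t := by simpa using (hasDerivAt_id t).const_mul w
      have hs := (hw.sin.const_mul w).mul (h1 t ht)
      have hco := hw.cos.mul (h2 t ht)
      convert! hs.add hco using 1
      ring
    -- Both integrations by parts at once, for the primitive `w sin(wt) ρ + cos(wt) ρ'`.
    have key := integral_Ioi_of_hasDerivAt_of_tendsto' hd
      (((hcos w hi).const_mul (w ^ 2)).add (hcos w hi'')) hlim
    rw [integral_add ((hcos w hi).const_mul (w ^ 2)) (hcos w hi''), integral_const_mul] at key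
    simp only [mul_zero, Real.sin_zero, zero_mul, Real.cos_zero, one_mul, zero_add, zero_sub]
      at key
    have hBB := habs w hi''
    have : J * w ^ 2 = -ρ' 0 - ∫ t in Set.Ioi 0, Real.cos (w * t) * ρ'' t := by
      rw [hJ]; linarith
    calc |J| * w ^ 2 = |J * w ^ 2| := by rw [abs_mul, abs_of_nonneg (sq_nonneg w)]
      _ ≤ _ := by
        rw [this]
        refine (abs_sub _ _).trans ?_
        rw [abs_neg]
        gcongr
  rw [← div_eq_mul_inv, le_div_iff₀ (by positivity)]
  linarith

theorem fourier_comp_abs_eq {ρ : ℝ → ℝ} (hi : Integrable fun y : ℝ => ρ |y|) (x : ℝ) :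
    𝓕 (fun y : ℝ => (ρ |y| : ℂ)) x
      = ((2 * ∫ t in Set.Ioi 0, Real.cos (2 * Real.pi * x * t) * ρ t : ℝ) : ℂ) := by
  have hcosi : Integrable fun y : ℝ => Real.cos (2 * Real.pi * x * y) * ρ |y| :=
    hi.bdd_mul (c := 1) (by fun_prop) (.of_forall fun t => by simpa using Real.abs_cos_le_one _)
  have hsini : Integrable fun y : ℝ => Real.sin (2 * Real.pi * x * y) * ρ |y| :=
    hi.bdd_mul (c := 1) (by fun_prop) (.of_forall fun t => by simpa using Real.abs_sin_le_one _)
  have hodd : ∫ y : ℝ, Real.sin (2 * Real.pi * x * y) * ρ |y| = 0 := by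
    have := integral_neg_eq_self (fun y : ℝ => Real.sin (2 * Real.pi * x * y) * ρ |y|) volume
    simp only [mul_neg, Real.sin_neg, neg_mul, abs_neg, integral_neg] at this
    linarith
  have heven : ∫ y : ℝ, Real.cos (2 * Real.pi * x * y) * ρ |y|
      = 2 * ∫ t in Set.Ioi 0, Real.cos (2 * Real.pi * x * t) * ρ t := by
    rw [← integral_comp_abs (f := fun t => Real.cos (2 * Real.pi * x * t) * ρ t)]
    congr 1
    ext y
    rcases abs_choice y with h | h <;> rw [h]
    rw [mul_neg, Real.cos_neg]
  rw [Real.fourier_real_eq_integral_exp_smul, ← heven]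
  have e : ∀ y : ℝ, Complex.exp (↑(-2 * Real.pi * y * x) * Complex.I) • (ρ |y| : ℂ)
      = ((Real.cos (2 * Real.pi * x * y) * ρ |y| : ℝ) : ℂ)
        - ((Real.sin (2 * Real.pi * x * y) * ρ |y| : ℝ) : ℂ) * Complex.I := by
    intro y
    rw [Complex.exp_mul_I, ← Complex.ofReal_cos, ← Complex.ofReal_sin,
      show -2 * Real.pi * y * x = -(2 * Real.pi * x * y) by ring, Real.cos_neg, Real.sin_neg]
    push_cast
    rw [smul_eq_mul]
    ring
  simp_rw [e]
  rw [integral_sub hcosi.ofReal (hsini.ofReal.mul_const _), integral_mul_const]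
  rw [show (∫ y : ℝ, ((Real.sin (2 * Real.pi * x * y) * ρ |y| : ℝ) : ℂ)) = 0 by
    rw [integral_complex_ofReal, hodd]; simp]
  rw [integral_complex_ofReal]
  simp

/-- The Fourier transform of a rational function of `|y|` of order `-2` without poles decays
quadratically. The jump of the derivative at `y = 0` permits no better decay in general. -/
theorem exists_norm_fourier_eval_div_le {P Q : ℝ[X]} (hdeg : P.natDegree + 2 ≤ Q.natDegree)
    (hQ : ∀ t : ℝ, 0 ≤ t → 0 < Q.eval t) :
    ∃ C, 0 < C ∧ ∀ x : ℝ, ‖𝓕 (fun y : ℝ => ((P.eval |y| / Q.eval |y| : ℝ) : ℂ)) x‖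
      ≤ C * (1 + x ^ 2)⁻¹ := by
  have hQ2 : ∀ t : ℝ, 0 ≤ t → 0 < (Q ^ 2).eval t := fun t ht => by
    rw [eval_pow]; exact pow_pos (hQ t ht) 2
  have hQ4 : ∀ t : ℝ, 0 ≤ t → 0 < ((Q ^ 2) ^ 2).eval t := fun t ht => by
    rw [eval_pow]; exact pow_pos (hQ2 t ht) 2
  have hd1 := natDegree_derivative_numerator_le hdeg
  have hd2 := natDegree_derivative_numerator_le hd1
  obtain ⟨C, hC, hb⟩ := exists_abs_eval_div_le hdeg hQ
  obtain ⟨C', _, hb'⟩ := exists_abs_eval_div_le hd1 hQ2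
  obtain ⟨C'', _, hb''⟩ := exists_abs_eval_div_le hd2 hQ4
  obtain ⟨D, hD⟩ := abs_integral_cos_mul_le
    (fun t ht => hasDerivAt_eval_div P Q (hQ t ht).ne')
    (fun t ht => hasDerivAt_eval_div _ (Q ^ 2) (hQ2 t ht).ne')
    (ContinuousOn.div (by fun_prop) (by fun_prop) fun t ht => (hQ4 t ht).ne') hb hb' hb''
  have hi : Integrable fun y : ℝ => P.eval |y| / Q.eval |y| := by
    refine (integrable_inv_one_add_sq.const_mul C).mono' ?_ (.of_forall fun y => ?_)
    · refine Continuous.aestronglyMeasurable (Continuous.div (by fun_prop) (by fun_prop)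
        fun y => (hQ _ (abs_nonneg y)).ne')
    · rw [Real.norm_eq_abs, ← sq_abs y]; exact hb |y| (abs_nonneg y)
  refine ⟨2 * |D| + 1, by positivity, fun x => ?_⟩
  rw [fourier_comp_abs_eq (ρ := fun t => P.eval t / Q.eval t) hi, Complex.norm_real,
    Real.norm_eq_abs, abs_mul, abs_two]
  have h1 := hD (2 * Real.pi * x)
  have h2 : (1 + (2 * Real.pi * x) ^ 2)⁻¹ ≤ (1 + x ^ 2)⁻¹ := by
    gcongr ?_⁻¹
    have : (1 : ℝ) ≤ (2 * Real.pi) ^ 2 := by nlinarith [Real.pi_gt_three]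
    rw [mul_pow]
    nlinarith [sq_nonneg x]
  have h3 : 0 < (1 + x ^ 2)⁻¹ := by positivity
  have h4 : D * (1 + (2 * Real.pi * x) ^ 2)⁻¹ ≤ |D| * (1 + x ^ 2)⁻¹ :=
    mul_le_mul (le_abs_self D) h2 (by positivity) (abs_nonneg D)
  linarith

end

end BFD

/-! ### Weighted `L¹` algebras and multipliers -/

namespace BFD

section

open Filter Topology Polynomial
open scoped Convolution

theorem integrable_fourierL2_of_memHs_one {f : ℝ → ℝ} (h : MemHs 1 f) :
    Integrable (fourierL2 f) := by
  have h2 := (memHs_iff.1 h).2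
  have hw : MemLp (fun y : ℝ => (((1 + y ^ 2) ^ (-(1 : ℝ) / 2) : ℝ) : ℂ)) 2 volume := by
    have hc : Continuous (fun y : ℝ => (((1 + y ^ 2) ^ (-(1 : ℝ) / 2) : ℝ) : ℂ)) :=
      Complex.continuous_ofReal.comp
        ((by fun_prop : Continuous fun y : ℝ => 1 + y ^ 2).rpow_const
          fun y => Or.inl (by positivity))
    rw [memLp_two_iff_integrable_sq_norm hc.aestronglyMeasurable]
    refine integrable_inv_one_add_sq.congr (.of_forall fun y => ?_)
    have : (0 : ℝ) ≤ 1 + y ^ 2 := by positivity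
    simp only [Complex.norm_real, Real.norm_eq_abs, sq_abs]
    rw [← Real.rpow_natCast ((1 + y ^ 2) ^ (-(1 : ℝ) / 2)) 2, ← Real.rpow_mul this,
      ← Real.rpow_neg_one]
    norm_num
  refine (hw.integrable_mul h2).congr (.of_forall fun y => ?_)
  simp only [Pi.mul_apply]
  rw [← mul_assoc, ← Complex.ofReal_mul, ← Real.rpow_add (by positivity)]
  norm_num

/-- Fourier inversion holds pointwise for the continuous representative of an `H¹` function. -/
theorem cplx_eq_fourierInv {f : ℝ → ℝ} (hc : Continuous f) (h : MemHs 1 f) :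
    cplx f = 𝓕⁻ (fourierL2 f) := by
  have hi := integrable_fourierL2_of_memHs_one h
  have hcc : Continuous (cplx f) := Complex.continuous_ofReal.comp hc
  exact (hcc.ae_eq_iff_eq volume (continuous_fourierInv hi)).1
    (cplx_ae_eq_fourierInv (memHs_iff.1 h).1 hi)

theorem tendsto_cocompact_of_memHs_one {f : ℝ → ℝ} (hc : Continuous f) (h : MemHs 1 f) :
    Tendsto f (cocompact ℝ) (𝓝 0) := by
  have h1 := Real.zero_at_infty_fourier (fourierL2 f)
  have h2 : Tendsto (fun x : ℝ => ‖𝓕 (fourierL2 f) (-x)‖) (cocompact ℝ) (𝓝 0) := by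
    have := (h1.comp (Homeomorph.neg ℝ).isClosedEmbedding.tendsto_cocompact).norm
    simpa using this
  refine squeeze_zero_norm (fun x => ?_) h2
  rw [← Real.fourierInv_eq_fourier_neg, ← cplx_eq_fourierInv hc h]
  simp [cplx]

theorem exists_abs_le_of_memHs_one {f : ℝ → ℝ} (hc : Continuous f) (h : MemHs 1 f) :
    ∃ B, ∀ x, |f x| ≤ B := by
  refine ⟨∫ y, ‖fourierL2 f y‖, fun x => ?_⟩
  have := norm_fourierInv_le (fourierL2 f) x
  rw [← cplx_eq_fourierInv hc h] at this
  simpa [cplx] using this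

theorem integrable_cplx_mul {f g : ℝ → ℝ} (hf : MemLp (cplx f) 2 volume)
    (hg : MemLp (cplx g) 2 volume) : Integrable (cplx fun x => f x * g x) := by
  refine (hf.integrable_mul hg).congr (.of_forall fun x => ?_)
  simp [cplx]

theorem memLp_cplx_mul {f g : ℝ → ℝ} (hfc : Continuous f) {B : ℝ} (hB : ∀ x, |f x| ≤ B)
    (hg : MemLp (cplx g) 2 volume) : MemLp (cplx fun x => f x * g x) 2 volume := by
  have hcc : Continuous (cplx f) := Complex.continuous_ofReal.comp hfc
  refine MemLp.of_le_mul (c := B) hg ?_ (.of_forall fun x => ?_)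
  · refine (hcc.aestronglyMeasurable.mul hg.1).congr (.of_forall fun x => ?_)
    simp [cplx]
  · simp only [cplx, Complex.norm_real, Real.norm_eq_abs, abs_mul]
    exact mul_le_mul_of_nonneg_right (hB x) (abs_nonneg _)

/-- The Fourier transform of a product is the convolution of the Fourier transforms. -/
theorem fourier_mul_eq_convolution {X Y : ℝ → ℂ} {f g : ℝ → ℂ} (hX : Integrable X)
    (hY : Integrable Y) (hYc : Continuous Y) (hYb : BddAbove (Set.range fun x => ‖Y x‖))
    (hf : f = 𝓕⁻ X) (hg : g = 𝓕⁻ Y) (hfg : Integrable fun x => f x * g x) :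
    𝓕 (fun x => f x * g x) = X ⋆[ContinuousLinearMap.mul ℂ ℂ] Y := by
  have hc : Continuous (X ⋆[ContinuousLinearMap.mul ℂ ℂ] Y) :=
    hYb.continuous_convolution_right_of_integrable _ hX hYc
  have hi : Integrable (X ⋆[ContinuousLinearMap.mul ℂ ℂ] Y) :=
    hX.integrable_convolution _ hY
  have e : ∀ x, 𝓕 (X ⋆[ContinuousLinearMap.mul ℂ ℂ] Y) x = f (-x) * g (-x) := fun x => by
    rw [Real.fourier_mul_convolution_eq hX hY, hf, hg, Real.fourierInv_eq_fourier_neg,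
      Real.fourierInv_eq_fourier_neg, neg_neg]
  have hi' : Integrable (𝓕 (X ⋆[ContinuousLinearMap.mul ℂ ℂ] Y)) :=
    hfg.comp_neg.congr (.of_forall fun x => (e x).symm)
  rw [← hc.fourier_fourierInv_eq hi hi']
  congr 1
  ext x
  rw [Real.fourierInv_eq_fourier_neg, e, neg_neg]

/-- The weights `(1 + |y|) ^ k` are submultiplicative, so the weighted `L¹` spaces are closed
under convolution. -/
theorem integrable_weight_mul_convolution {X Y : ℝ → ℂ} {k : ℕ}
    (hX : Integrable X) (hY : Integrable Y)
    (hXk : Integrable fun y : ℝ => (1 + |y|) ^ k * ‖X y‖)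
    (hYk : Integrable fun y : ℝ => (1 + |y|) ^ k * ‖Y y‖) :
    Integrable fun y : ℝ => (1 + |y|) ^ k * ‖(X ⋆[ContinuousLinearMap.mul ℂ ℂ] Y) y‖ := by
  have hi := hX.integrable_convolution (ContinuousLinearMap.mul ℂ ℂ) hY
  refine (hXk.integrable_convolution (ContinuousLinearMap.mul ℝ ℝ) hYk).mono'
    ((by fun_prop : Continuous fun y : ℝ => (1 + |y|) ^ k).aestronglyMeasurable.mul hi.1.norm) ?_
  filter_upwards [hXk.ae_convolution_exists (ContinuousLinearMap.mul ℝ ℝ) hYk] with y hy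
  rw [Real.norm_of_nonneg (by positivity), convolution_def, convolution_def]
  calc _ ≤ (1 + |y|) ^ k * ∫ t, ‖X t‖ * ‖Y (y - t)‖ := by
        gcongr
        refine (norm_integral_le_integral_norm _).trans_eq ?_
        simp
    _ = ∫ t, (1 + |y|) ^ k * (‖X t‖ * ‖Y (y - t)‖) := (integral_const_mul _ _).symm
    _ ≤ _ := by
        refine integral_mono_of_nonneg (.of_forall fun t => by positivity) hy
          (.of_forall fun t => ?_)
        simp only [ContinuousLinearMap.mul_apply']
        have h1 : 1 + |y| ≤ (1 + |t|) * (1 + |y - t|) := by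
          have : |y| ≤ |t| + |y - t| := by
            simpa using abs_add_le t (y - t)
          nlinarith [mul_nonneg (abs_nonneg t) (abs_nonneg (y - t))]
        have h2 : (1 + |y|) ^ k ≤ (1 + |t|) ^ k * (1 + |y - t|) ^ k := by
          rw [← mul_pow]; gcongr
        calc _ ≤ ((1 + |t|) ^ k * (1 + |y - t|) ^ k) * (‖X t‖ * ‖Y (y - t)‖) := by gcongr
          _ = _ := by ring

/-- A Fourier multiplier with integrable symbol acts on `L¹` by convolution with its kernel. -/
theorem fourierInv_mul_fourier {m N : ℝ → ℂ} (hm : Integrable m) (hN : Integrable N) (x : ℝ) :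
    𝓕⁻ (fun y => m y * 𝓕 N y) x = ∫ z, 𝓕 m (z - x) * N z := by
  have hme : Integrable fun y => Real.fourierChar (y * x) • m y := by
    have := (Real.fourierIntegral_convergent_iff (f := m) (-x)).2 hm
    refine this.congr (.of_forall fun y => ?_)
    simp [mul_comm]
  have h := VectorFourier.integral_fourierIntegral_smul_eq_flip (μ := volume) (ν := volume)
    (L := innerₗ ℝ) (f := fun y => Real.fourierChar (y * x) • m y) (g := N)
    Real.continuous_fourierChar continuous_inner hme hN
  simp only [flip_innerₗ] at h
  have e1 : ∀ z, VectorFourier.fourierIntegral Real.fourierChar volume (innerₗ ℝ)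
      (fun y => Real.fourierChar (y * x) • m y) z = 𝓕 m (z - x) := by
    intro z
    rw [Real.fourier_real_eq]
    simp only [VectorFourier.fourierIntegral]
    refine integral_congr_ae (.of_forall fun y => ?_)
    simp only [smul_smul, ← AddChar.map_add_eq_mul]
    congr 2
    simp only [innerₗ_apply_apply, RCLike.inner_apply, conj_trivial]
    ring
  simp only [e1, smul_eq_mul] at h
  rw [h, Real.fourierInv_eq]
  refine integral_congr_ae (.of_forall fun y => ?_)
  simp only [RCLike.inner_apply, conj_trivial, Circle.smul_def, smul_eq_mul]
  rw [mul_comm x y, mul_assoc]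
  rfl

end

end BFD

/-! ### Regularity and decay for quadratic systems with multipliers of order `-2` -/

namespace BFD

section

open Filter Topology Polynomial
open scoped Convolution

/-- The Fourier multiplier `P(|y|) / Q(|y|)`. -/
noncomputable def ratSymbol (P Q : ℝ[X]) (y : ℝ) : ℂ := ((P.eval |y| / Q.eval |y| : ℝ) : ℂ)

section ratSymbol

variable {P Q : ℝ[X]}

theorem continuous_ratSymbol (hQ : ∀ t : ℝ, 0 ≤ t → 0 < Q.eval t) :
    Continuous (ratSymbol P Q) :=
  Complex.continuous_ofReal.comp (Continuous.div (by fun_prop) (by fun_prop)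
    fun y => (hQ _ (abs_nonneg y)).ne')

theorem exists_norm_ratSymbol_le (hdeg : P.natDegree + 2 ≤ Q.natDegree)
    (hQ : ∀ t : ℝ, 0 ≤ t → 0 < Q.eval t) :
    ∃ C, 0 < C ∧ ∀ y : ℝ, ‖ratSymbol P Q y‖ ≤ C * (1 + y ^ 2)⁻¹ := by
  obtain ⟨C, hC, h⟩ := exists_abs_eval_div_le hdeg hQ
  refine ⟨C, hC, fun y => ?_⟩
  rw [ratSymbol, Complex.norm_real, Real.norm_eq_abs, ← sq_abs y]
  exact h _ (abs_nonneg y)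

theorem integrable_ratSymbol (hdeg : P.natDegree + 2 ≤ Q.natDegree)
    (hQ : ∀ t : ℝ, 0 ≤ t → 0 < Q.eval t) : Integrable (ratSymbol P Q) := by
  obtain ⟨C, _, h⟩ := exists_norm_ratSymbol_le hdeg hQ
  exact (integrable_inv_one_add_sq.const_mul C).mono'
    (continuous_ratSymbol hQ).aestronglyMeasurable (.of_forall h)

/-- Multipliers of order `-2` gain one power of the weight in `L¹`. -/
theorem integrable_weight_succ_ratSymbol_mul (hdeg : P.natDegree + 2 ≤ Q.natDegree)
    (hQ : ∀ t : ℝ, 0 ≤ t → 0 < Q.eval t) {k : ℕ} {G : ℝ → ℂ} (hG : Continuous G)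
    (hGk : Integrable fun y : ℝ => (1 + |y|) ^ k * ‖G y‖) :
    Integrable fun y : ℝ => (1 + |y|) ^ (k + 1) * ‖ratSymbol P Q y * G y‖ := by
  obtain ⟨C, hC, h⟩ := exists_norm_ratSymbol_le hdeg hQ
  have hm : Continuous (ratSymbol P Q) := continuous_ratSymbol hQ
  refine (hGk.const_mul (2 * C)).mono' (by fun_prop) (.of_forall fun y => ?_)
  rw [Real.norm_of_nonneg (by positivity), norm_mul]
  have h1 : (1 + |y|) * ‖ratSymbol P Q y‖ ≤ 2 * C := by
    calc (1 + |y|) * ‖ratSymbol P Q y‖ ≤ (2 * (1 + y ^ 2)) * (C * (1 + y ^ 2)⁻¹) := by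
          refine mul_le_mul ?_ (h y) (norm_nonneg _) (by positivity)
          rw [← sq_abs y]
          nlinarith [sq_nonneg (|y| - 1)]
      _ = 2 * C := by field_simp
  calc _ = ((1 + |y|) * ‖ratSymbol P Q y‖) * ((1 + |y|) ^ k * ‖G y‖) := by ring
    _ ≤ _ := by gcongr

/-- The kernel of a multiplier of order `-2` is dominated by `1 / (1 + x²)`. -/
theorem exists_norm_fourierInv_ratSymbol_mul_le (hdeg : P.natDegree + 2 ≤ Q.natDegree)
    (hQ : ∀ t : ℝ, 0 ≤ t → 0 < Q.eval t) :
    ∃ C, 0 < C ∧ ∀ N : ℝ → ℂ, Integrable N → ∀ x : ℝ,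
      ‖𝓕⁻ (fun y => ratSymbol P Q y * 𝓕 N y) x‖ ≤ C * ∫ z, (1 + (x - z) ^ 2)⁻¹ * ‖N z‖ := by
  obtain ⟨C, hC, h⟩ := exists_norm_fourier_eval_div_le hdeg hQ
  refine ⟨C, hC, fun N hN x => ?_⟩
  rw [fourierInv_mul_fourier (integrable_ratSymbol hdeg hQ) hN, ← integral_const_mul]
  refine (norm_integral_le_integral_norm _).trans (integral_mono_of_nonneg
    (.of_forall fun z => norm_nonneg _) ?_ (.of_forall fun z => ?_))
  · refine ((hN.norm.bdd_mul (c := 1) (by fun_prop) (.of_forall fun z => ?_))).const_mul C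
    rw [Real.norm_of_nonneg (by positivity)]
    exact inv_le_one_of_one_le₀ (by nlinarith [sq_nonneg (x - z)])
  · simp only [norm_mul]
    rw [← mul_assoc, ← neg_sub z x, neg_sq]
    gcongr
    exact h (z - x)

end ratSymbol

/-- A bounded Fourier transform in all weighted `L¹` spaces is in all weighted `L²` spaces. -/
theorem memHInfty_of_weighted {f : ℝ → ℝ} {X : ℝ → ℂ} (hf : MemLp (cplx f) 2 volume)
    (hX : fourierL2 f =ᵐ[volume] X) (hXc : Continuous X) {B : ℝ} (hB : ∀ y, ‖X y‖ ≤ B)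
    (hk : ∀ k : ℕ, Integrable fun y : ℝ => (1 + |y|) ^ k * ‖X y‖) : MemHInfty f := by
  intro s
  refine memHs_iff.2 ⟨hf, ?_⟩
  have hwc : Continuous fun y : ℝ => (((1 + y ^ 2) ^ (s / 2) : ℝ) : ℂ) :=
    Complex.continuous_ofReal.comp ((by fun_prop : Continuous fun y : ℝ => 1 + y ^ 2).rpow_const
      fun y => Or.inl (by positivity))
  have hL : MemLp (fun y => (((1 + y ^ 2) ^ (s / 2) : ℝ) : ℂ) * X y) 2 volume := by
    rw [memLp_two_iff_integrable_sq_norm (by fun_prop)]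
    obtain ⟨n, hn⟩ := exists_nat_ge s
    refine ((hk (2 * n)).const_mul B).mono' (by fun_prop) (.of_forall fun y => ?_)
    rw [Real.norm_of_nonneg (by positivity), norm_mul, mul_pow, Complex.norm_real,
      Real.norm_eq_abs, sq_abs]
    have h1 : (1 : ℝ) ≤ 1 + y ^ 2 := by nlinarith [sq_nonneg y]
    have h2 : ((1 + y ^ 2) ^ (s / 2)) ^ 2 ≤ (1 + |y|) ^ (2 * n) := by
      rw [← Real.rpow_natCast ((1 + y ^ 2) ^ (s / 2)) 2, ← Real.rpow_mul (by positivity)]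
      calc (1 + y ^ 2) ^ (s / 2 * (2 : ℕ)) ≤ (1 + y ^ 2) ^ (n : ℝ) :=
            Real.rpow_le_rpow_of_exponent_le h1 (by push_cast; linarith)
        _ = (1 + y ^ 2) ^ n := Real.rpow_natCast _ _
        _ ≤ _ := by
          rw [pow_mul]
          gcongr
          rw [← sq_abs y]
          nlinarith [abs_nonneg y]
    calc _ ≤ (1 + |y|) ^ (2 * n) * (B * ‖X y‖) := by
          refine mul_le_mul h2 ?_ (by positivity) (by positivity)
          rw [sq]
          exact mul_le_mul_of_nonneg_right (hB y) (norm_nonneg _)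
      _ = _ := by ring
  refine (memLp_congr_ae ?_).2 hL
  filter_upwards [hX] with y hy
  rw [hy]

/-- Regularity and decay for `ξ = K₁ * (ξν) + K₂ * ν²`, `ν = K₃ * (ξν) + K₄ * ν²`, where the
`Kᵢ` have rational symbols in `|y|` of order `-2`. -/
theorem memHInfty_and_decay_of_ratSymbol_system {ξ ν : ℝ → ℝ} (hξc : Continuous ξ)
    (hνc : Continuous ν) (hξ : MemHs 1 ξ) (hν : MemHs 1 ν) {P₁ P₂ P₃ P₄ Q : ℝ[X]}
    (hQ : ∀ t : ℝ, 0 ≤ t → 0 < Q.eval t)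
    (hd₁ : P₁.natDegree + 2 ≤ Q.natDegree) (hd₂ : P₂.natDegree + 2 ≤ Q.natDegree)
    (hd₃ : P₃.natDegree + 2 ≤ Q.natDegree) (hd₄ : P₄.natDegree + 2 ≤ Q.natDegree)
    (e₁ : ∀ᵐ y, fourierL2 ξ y = ratSymbol P₁ Q y * fourierL2 (fun x => ξ x * ν x) y
      + ratSymbol P₂ Q y * fourierL2 (fun x => ν x ^ 2) y)
    (e₂ : ∀ᵐ y, fourierL2 ν y = ratSymbol P₃ Q y * fourierL2 (fun x => ξ x * ν x) y
      + ratSymbol P₄ Q y * fourierL2 (fun x => ν x ^ 2) y) :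
    MemHInfty ξ ∧ MemHInfty ν ∧
      ∃ D : ℝ, ∀ x : ℝ, x ^ 2 * |ξ x| ≤ D ∧ x ^ 2 * |ν x| ≤ D := by
  have hξ2 := (memHs_iff.1 hξ).1
  have hν2 := (memHs_iff.1 hν).1
  obtain ⟨Bξ, hBξ⟩ := exists_abs_le_of_memHs_one hξc hξ
  obtain ⟨Bν, hBν⟩ := exists_abs_le_of_memHs_one hνc hν
  simp_rw [sq (ν _)] at e₁ e₂
  have hN₁ := integrable_cplx_mul hξ2 hν2
  have hN₂ := integrable_cplx_mul hν2 hν2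
  set N₁ := cplx fun x => ξ x * ν x with hN₁def
  set N₂ := cplx fun x => ν x * ν x with hN₂def
  have hF₁ := fourierL2_ae_eq hN₁ (memLp_cplx_mul hξc hBξ hν2)
  have hF₂ := fourierL2_ae_eq hN₂ (memLp_cplx_mul hνc hBν hν2)
  have hG₁ := continuous_fourier hN₁
  have hG₂ := continuous_fourier hN₂
  -- The continuous representatives of the Fourier transforms of `ξ` and `ν`.
  have rep : ∀ {P P' : ℝ[X]} {f : ℝ → ℝ}, Continuous f → MemHs 1 f →
      P.natDegree + 2 ≤ Q.natDegree → P'.natDegree + 2 ≤ Q.natDegree →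
      (∀ᵐ y, fourierL2 f y = ratSymbol P Q y * fourierL2 (fun x => ξ x * ν x) y
        + ratSymbol P' Q y * fourierL2 (fun x => ν x * ν x) y) →
      ∃ X : ℝ → ℂ, (X = fun y => ratSymbol P Q y * 𝓕 N₁ y + ratSymbol P' Q y * 𝓕 N₂ y) ∧
        fourierL2 f =ᵐ[volume] X ∧ Continuous X ∧ Integrable X ∧ (∃ B, ∀ y, ‖X y‖ ≤ B) ∧
        cplx f = 𝓕⁻ X := by
    intro P P' f hfc hf hd hd' e
    have hm := continuous_ratSymbol (P := P) hQ
    have hm' := continuous_ratSymbol (P := P') hQ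
    have hX : fourierL2 f =ᵐ[volume]
        fun y => ratSymbol P Q y * 𝓕 N₁ y + ratSymbol P' Q y * 𝓕 N₂ y := by
      filter_upwards [e, hF₁, hF₂] with y h h1 h2
      rw [h, h1, h2]
    refine ⟨_, rfl, hX, by fun_prop, (integrable_fourierL2_of_memHs_one hf).congr hX, ?_, ?_⟩
    · obtain ⟨C, hC, h⟩ := exists_norm_ratSymbol_le hd hQ
      obtain ⟨C', hC', h'⟩ := exists_norm_ratSymbol_le hd' hQ
      have hinv : ∀ y : ℝ, (1 + y ^ 2)⁻¹ ≤ 1 := fun y =>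
        inv_le_one_of_one_le₀ (by nlinarith [sq_nonneg y])
      refine ⟨C * (∫ x, ‖N₁ x‖) + C' * ∫ x, ‖N₂ x‖, fun y => ?_⟩
      refine (norm_add_le _ _).trans ?_
      rw [norm_mul, norm_mul]
      gcongr
      · exact (h y).trans (mul_le_of_le_one_right hC.le (hinv y))
      · exact norm_fourier_le _ _
      · exact (h' y).trans (mul_le_of_le_one_right hC'.le (hinv y))
      · exact norm_fourier_le _ _
    · rw [cplx_eq_fourierInv hfc hf]
      ext x
      rw [Real.fourierInv_eq_fourier_neg, Real.fourierInv_eq_fourier_neg]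
      exact Real.fourier_congr_ae hX _
  obtain ⟨X, hXdef, hX, hXc, hXi, ⟨BX, hBX⟩, hXinv⟩ := rep hξc hξ hd₁ hd₂ e₁
  obtain ⟨Y, hYdef, hY, hYc, hYi, ⟨BY, hBY⟩, hYinv⟩ := rep hνc hν hd₃ hd₄ e₂
  have hYbd : BddAbove (Set.range fun y => ‖Y y‖) := ⟨BY, by rintro _ ⟨y, rfl⟩; exact hBY y⟩
  have hconv : ∀ {Z : ℝ → ℂ} {f : ℝ → ℝ}, Integrable Z → cplx f = 𝓕⁻ Z →
      Integrable (cplx fun x => f x * ν x) →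
      𝓕 (cplx fun x => f x * ν x) = Z ⋆[ContinuousLinearMap.mul ℂ ℂ] Y := by
    intro Z f hZ hf hi
    have e : (cplx fun x => f x * ν x) = fun x => cplx f x * cplx ν x := by
      ext x; simp [cplx]
    rw [e] at hi ⊢
    exact fourier_mul_eq_convolution hZ hYi hYc hYbd hf hYinv hi
  have hC₁ := hconv hXi hXinv hN₁
  have hC₂ := hconv hYi hYinv hN₂
  -- Bootstrap: each step gains one power of the weight.
  have boot : ∀ k : ℕ, (Integrable fun y : ℝ => (1 + |y|) ^ k * ‖X y‖) ∧
      Integrable fun y : ℝ => (1 + |y|) ^ k * ‖Y y‖ := by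
    intro k
    induction k with
    | zero => simpa using ⟨hXi.norm, hYi.norm⟩
    | succ k ih =>
      have g₁ := integrable_weight_mul_convolution hXi hYi ih.1 ih.2
      have g₂ := integrable_weight_mul_convolution hYi hYi ih.2 ih.2
      rw [← hC₁] at g₁
      rw [← hC₂] at g₂
      have step : ∀ {P P' : ℝ[X]} {Z : ℝ → ℂ}, Continuous Z →
          P.natDegree + 2 ≤ Q.natDegree → P'.natDegree + 2 ≤ Q.natDegree →
          (Z = fun y => ratSymbol P Q y * 𝓕 N₁ y + ratSymbol P' Q y * 𝓕 N₂ y) →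
          Integrable fun y : ℝ => (1 + |y|) ^ (k + 1) * ‖Z y‖ := by
        intro P P' Z hZ hd hd' e
        refine ((integrable_weight_succ_ratSymbol_mul hd hQ hG₁ g₁).add
          (integrable_weight_succ_ratSymbol_mul hd' hQ hG₂ g₂)).mono' (by fun_prop)
          (.of_forall fun y => ?_)
        rw [Real.norm_of_nonneg (by positivity), e, Pi.add_apply, ← mul_add]
        gcongr
        exact norm_add_le _ _
      exact ⟨step hXc hd₁ hd₂ hXdef, step hYc hd₃ hd₄ hYdef⟩
  refine ⟨memHInfty_of_weighted hξ2 hX hXc hBX fun k => (boot k).1,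
    memHInfty_of_weighted hν2 hY hYc hBY fun k => (boot k).2, ?_⟩
  have hUi : ∀ x : ℝ, Integrable fun z => (1 + (x - z) ^ 2)⁻¹ * (|ξ z| + |ν z|) ^ 2 := by
    intro x
    have h1 : Integrable fun z => (|ξ z| + |ν z|) ^ 2 := by
      refine (((integrable_cplx_mul hξ2 hξ2).norm.const_mul 2).add (hN₂.norm.const_mul 2)).mono'
        (by fun_prop) (.of_forall fun z => ?_)
      simp only [hN₂def, cplx, Pi.add_apply, Complex.norm_real, Real.norm_eq_abs, abs_mul]
      rw [abs_of_nonneg (by positivity)]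
      nlinarith [sq_nonneg (|ξ z| - |ν z|)]
    refine h1.bdd_mul (c := 1) (by fun_prop) (.of_forall fun z => ?_)
    rw [Real.norm_of_nonneg (by positivity)]
    exact inv_le_one_of_one_le₀ (by nlinarith [sq_nonneg (x - z)])
  have kern : ∀ {P P' : ℝ[X]} {f : ℝ → ℝ} {Z : ℝ → ℂ},
      P.natDegree + 2 ≤ Q.natDegree → P'.natDegree + 2 ≤ Q.natDegree →
      (Z = fun y => ratSymbol P Q y * 𝓕 N₁ y + ratSymbol P' Q y * 𝓕 N₂ y) →
      cplx f = 𝓕⁻ Z → ∃ C, 0 < C ∧ ∀ x, |f x| ≤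
        C * ∫ z, (1 + (x - z) ^ 2)⁻¹ * (|ξ z| + |ν z|) ^ 2 := by
    intro P P' f Z hd hd' e hf
    obtain ⟨C, hC, h⟩ := exists_norm_fourierInv_ratSymbol_mul_le hd hQ
    obtain ⟨C', hC', h'⟩ := exists_norm_fourierInv_ratSymbol_mul_le hd' hQ
    refine ⟨C + C', by positivity, fun x => ?_⟩
    have hbd : ∀ {R : ℝ[X]}, R.natDegree + 2 ≤ Q.natDegree → ∀ {N : ℝ → ℂ}, Integrable N →
        Integrable fun y => ratSymbol R Q y * 𝓕 N y := fun {R} hR {N} hN =>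
      (integrable_ratSymbol hR hQ).mul_bdd (continuous_fourier hN).aestronglyMeasurable
        (.of_forall (norm_fourier_le N))
    have hadd : 𝓕⁻ Z x = 𝓕⁻ (fun y => ratSymbol P Q y * 𝓕 N₁ y) x
        + 𝓕⁻ (fun y => ratSymbol P' Q y * 𝓕 N₂ y) x := by
      have i₁ := (Real.fourierIntegral_convergent_iff (-x)).2 (hbd hd hN₁)
      have i₂ := (Real.fourierIntegral_convergent_iff (-x)).2 (hbd hd' hN₂)
      simp only [Real.fourierInv_eq_fourier_neg]
      rw [Real.fourier_eq Z, Real.fourier_eq fun y => ratSymbol P Q y * 𝓕 N₁ y,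
        Real.fourier_eq fun y => ratSymbol P' Q y * 𝓕 N₂ y, ← integral_add i₁ i₂, e]
      simp only [smul_add]
    have hfx : |f x| = ‖𝓕⁻ Z x‖ := by rw [← hf]; simp [cplx]
    rw [hfx, hadd, add_mul]
    refine (norm_add_le _ _).trans (add_le_add ((h _ hN₁ x).trans ?_) ((h' _ hN₂ x).trans ?_))
    · refine mul_le_mul_of_nonneg_left ?_ (le_of_lt ‹_›)
      refine integral_mono_of_nonneg (.of_forall fun z => by positivity) (hUi x)
        (.of_forall fun z => ?_)
      simp only [hN₁def, cplx, Complex.norm_real, Real.norm_eq_abs, abs_mul]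
      gcongr
      nlinarith [abs_nonneg (ξ z), abs_nonneg (ν z), mul_nonneg (abs_nonneg (ξ z)) (abs_nonneg (ν z))]
    · refine mul_le_mul_of_nonneg_left ?_ (le_of_lt ‹_›)
      refine integral_mono_of_nonneg (.of_forall fun z => by positivity) (hUi x)
        (.of_forall fun z => ?_)
      simp only [hN₂def, cplx, Complex.norm_real, Real.norm_eq_abs, abs_mul]
      gcongr
      nlinarith [abs_nonneg (ξ z), abs_nonneg (ν z), mul_nonneg (abs_nonneg (ξ z)) (abs_nonneg (ν z))]
  obtain ⟨C, hC, h⟩ := kern hd₁ hd₂ hXdef hXinv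
  obtain ⟨C', hC', h'⟩ := kern hd₃ hd₄ hYdef hYinv
  have hlim : Tendsto (fun x => |ξ x| + |ν x|) (cocompact ℝ) (𝓝 0) := by
    simpa using (tendsto_cocompact_of_memHs_one hξc hξ).abs.add
      (tendsto_cocompact_of_memHs_one hνc hν).abs
  obtain ⟨D, hD⟩ := exists_le_inv_one_add_sq (U := fun x => |ξ x| + |ν x|) (B := Bξ + Bν)
    (C := C + C') (by positivity) (fun x => by positivity) (fun x => add_le_add (hBξ x) (hBν x))
    hlim fun x => by
      rw [add_mul]
      exact add_le_add (h x) (h' x)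
  refine ⟨|D|, fun x => ?_⟩
  have key : x ^ 2 * (|ξ x| + |ν x|) ≤ |D| := by
    have hx : 0 < 1 + x ^ 2 := by positivity
    have := hD x
    rw [← div_eq_mul_inv, le_div_iff₀ hx] at this
    have := le_abs_self D
    have : 0 ≤ |ξ x| + |ν x| := by positivity
    nlinarith
  have hx := sq_nonneg x
  constructor
  · nlinarith [abs_nonneg (ν x)]
  · nlinarith [abs_nonneg (ξ x)]

end

end BFD

/-! ### Inversion of the linear part -/

namespace BFD

section

open Filter Topology Polynomial

theorem leading_coeff_pos_of_quartic_pos {k₀ k₁ k₂ k₃ k₄ : ℝ} (h3 : k₃ < 0)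
    (h : ∀ t : ℝ, 0 ≤ t → 0 < k₄ * t ^ 4 + k₃ * t ^ 3 + k₂ * t ^ 2 + k₁ * t + k₀) : 0 < k₄ := by
  by_contra! h4
  set S := |k₂| + |k₁| + |k₀| with hS
  set t := 1 + S / (-k₃) with ht
  have hS0 : 0 ≤ S := by positivity
  have ht1 : 1 ≤ t := by
    have : 0 ≤ S / (-k₃) := div_nonneg hS0 (by linarith)
    linarith
  have hkt : k₃ * t + S ≤ 0 := by
    have : k₃ * t = k₃ - S := by
      rw [ht]
      have : k₃ ≠ 0 := h3.ne
      field_simp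
      ring
    linarith
  have hpos := h t (by linarith)
  have a1 : k₄ * t ^ 4 ≤ 0 := mul_nonpos_of_nonpos_of_nonneg h4 (by positivity)
  have a2 : k₂ * t ^ 2 ≤ |k₂| * t ^ 2 := by gcongr; exact le_abs_self _
  have a3 : k₁ * t ≤ |k₁| * t ^ 2 := by
    have h1 : k₁ * t ≤ |k₁| * t := by gcongr; exact le_abs_self _
    have h2 : |k₁| * t ≤ |k₁| * t ^ 2 := by gcongr; nlinarith
    linarith
  have a4 : k₀ ≤ |k₀| * t ^ 2 := by
    have h1 := le_abs_self k₀
    have h2 : |k₀| * 1 ≤ |k₀| * t ^ 2 := by gcongr; nlinarith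
    linarith
  have a5 : t ^ 2 * (k₃ * t + S) ≤ 0 := mul_nonpos_of_nonneg_of_nonpos (by positivity) hkt
  rw [hS] at a5
  nlinarith

/-- The determinant `(1 - γ) J_c L - (ω J_b)²` of the symbol of the linear part, as a polynomial in
`|θ|`. -/
noncomputable def detPoly (γ μ a b c ω : ℝ) : ℝ[X] :=
  C ((1 - γ) * (μ * c) * (μ / γ * (a - 1 / γ ^ 2)) - (ω * (μ * b)) ^ 2) * X ^ 4
    + C ((1 - γ) * (μ * c) * (√μ / γ ^ 2)) * X ^ 3
    + C (-(1 - γ) * (μ / γ * (a - 1 / γ ^ 2) + μ * c * (1 / γ)) - 2 * ω ^ 2 * (μ * b)) * X ^ 2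
    + C (-(1 - γ) * (√μ / γ ^ 2)) * X + C ((1 - γ) * (1 / γ) - ω ^ 2)

theorem eval_detPoly (γ μ a b c ω θ : ℝ) : (detPoly γ μ a b c ω).eval |θ| =
    (1 - γ) * symJc μ c θ * symL γ μ a θ - (ω * symJb μ b θ) ^ 2 := by
  simp only [detPoly, symJc, symL, symJb, eval_add, eval_mul, eval_C, eval_pow, eval_X, ← sq_abs θ]
  ring

/-- Positivity of the determinant at all frequencies includes ellipticity: its cubic coefficient
is negative, so its leading coefficient cannot vanish. -/
theorem natDegree_detPoly {γ μ a b c ω : ℝ} (hγ0 : 0 < γ) (hγ1 : γ < 1) (hμ : 0 < μ) (hc : c < 0)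
    (h : SymbolPosDef γ μ a b c ω) : (detPoly γ μ a b c ω).natDegree = 4 := by
  have hk3 : (1 - γ) * (μ * c) * (√μ / γ ^ 2) < 0 := by
    have h1 : 0 < √μ / γ ^ 2 := by positivity
    have h2 : μ * c < 0 := mul_neg_of_pos_of_neg hμ hc
    have h3 : 0 < 1 - γ := by linarith
    exact mul_neg_of_neg_of_pos (mul_neg_of_pos_of_neg h3 h2) h1
  have hk4 := leading_coeff_pos_of_quartic_pos hk3 (k₀ := (1 - γ) * (1 / γ) - ω ^ 2)
    (k₁ := -(1 - γ) * (√μ / γ ^ 2))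
    (k₂ := -(1 - γ) * (μ / γ * (a - 1 / γ ^ 2) + μ * c * (1 / γ)) - 2 * ω ^ 2 * (μ * b))
    (k₄ := (1 - γ) * (μ * c) * (μ / γ * (a - 1 / γ ^ 2)) - (ω * (μ * b)) ^ 2) fun t ht => by
      have h1 := h t
      have h2 := eval_detPoly γ μ a b c ω t
      rw [abs_of_nonneg ht] at h2
      simp only [detPoly, eval_add, eval_mul, eval_C, eval_pow, eval_X] at h2
      rw [h2]
      linarith
  have hne := hk4.ne'
  unfold detPoly
  compute_degree!
  simpa using hne

theorem eval_comp_two_pi_mul_abs (p : ℝ[X]) (y : ℝ) :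
    (p.comp (C (2 * Real.pi) * X)).eval |y| = p.eval |2 * Real.pi * y| := by
  rw [abs_mul, abs_of_pos Real.two_pi_pos]
  simp

/-- Regularity and decay of solitary waves under positivity of the symbol, obtained by inverting
the symbol of the linear part. -/
theorem memHInfty_and_decay_of_symbolPosDef {γ ε μ a b c ω : ℝ} (hγ0 : 0 < γ) (hγ1 : γ < 1)
    (hμ : 0 < μ) (hc : c < 0) {ξ ν : ℝ → ℝ} (hξ : Continuous ξ) (hν : Continuous ν)
    (hsol : IsSolitaryWave γ ε μ a b c ω ξ ν) (hpos : SymbolPosDef γ μ a b c ω) :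
    MemHInfty ξ ∧ MemHInfty ν ∧
      ∃ D : ℝ, ∀ x : ℝ, x ^ 2 * |ξ x| ≤ D ∧ x ^ 2 * |ν x| ≤ D := by
  set s : ℝ[X] := C (2 * Real.pi) * X with hs
  have hs1 : s.natDegree = 1 := natDegree_C_mul_X _ Real.two_pi_pos.ne'
  set Q := (detPoly γ μ a b c ω).comp s with hQdef
  have hQ4 : Q.natDegree = 4 := by
    rw [hQdef, natDegree_comp, hs1, natDegree_detPoly hγ0 hγ1 hμ hc hpos]
  have hQeval : ∀ y : ℝ, Q.eval |y| = (1 - γ) * symJc μ c (2 * Real.pi * y)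
      * symL γ μ a (2 * Real.pi * y) - (ω * symJb μ b (2 * Real.pi * y)) ^ 2 := fun y => by
    rw [hQdef, hs, eval_comp_two_pi_mul_abs, eval_detPoly]
  have hQ : ∀ t : ℝ, 0 ≤ t → 0 < Q.eval t := fun t ht => by
    rw [← abs_of_nonneg ht, hQeval]
    have := hpos (2 * Real.pi * t)
    linarith
  -- The entries of the inverse matrix are quadratic in `|θ|`.
  set jb : ℝ[X] := C ω * (1 + C (μ * b) * X ^ 2) with hjb
  set jc : ℝ[X] := C (1 - γ) * (1 - C (μ * c) * X ^ 2) with hjc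
  set l : ℝ[X] := C (1 / γ) - C (√μ / γ ^ 2) * X - C (μ / γ * (a - 1 / γ ^ 2)) * X ^ 2 with hl
  have djb : jb.natDegree ≤ 2 := by rw [hjb]; compute_degree
  have djc : jc.natDegree ≤ 2 := by rw [hjc]; compute_degree
  have dl : l.natDegree ≤ 2 := by rw [hl]; compute_degree
  have ejb : ∀ θ : ℝ, jb.eval |θ| = ω * symJb μ b θ := fun θ => by simp [hjb, symJb]
  have ejc : ∀ θ : ℝ, jc.eval |θ| = (1 - γ) * symJc μ c θ := fun θ => by simp [hjc, symJc]
  have el : ∀ θ : ℝ, l.eval |θ| = symL γ μ a θ := fun θ => by simp [hl, symL]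
  have hdeg : ∀ (k : ℝ) {p : ℝ[X]}, p.natDegree ≤ 2 →
      (C k * p.comp s).natDegree + 2 ≤ Q.natDegree := fun k p hp => by
    rw [hQ4]
    have h1 : (C k * p.comp s).natDegree ≤ (p.comp s).natDegree := natDegree_C_mul_le _ _
    rw [natDegree_comp, hs1] at h1
    omega
  have hsym : ∀ (k : ℝ) (p : ℝ[X]) (y : ℝ), ratSymbol (C k * p.comp s) Q y
      = (k : ℂ) * (p.eval |2 * Real.pi * y| : ℝ) / ((Q.eval |y| : ℝ) : ℂ) := fun k p y => by
    rw [ratSymbol, eval_mul, eval_C, hs, eval_comp_two_pi_mul_abs]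
    push_cast
    ring
  refine memHInfty_and_decay_of_ratSymbol_system hξ hν hsol.memH1_fst hsol.memH1_snd hQ
    (hdeg (ε / γ) djb) (hdeg (ε / (2 * γ)) dl) (hdeg (ε / γ) djc) (hdeg (ε / (2 * γ)) djb) ?_ ?_
  · filter_upwards [hsol.eq_fst, hsol.eq_snd] with y h1 h2
    have hne : ((Q.eval |y| : ℝ) : ℂ) ≠ 0 := by exact_mod_cast (hQ _ (abs_nonneg y)).ne'
    rw [hsym, hsym, ejb, el, div_mul_eq_mul_div, div_mul_eq_mul_div, ← add_div, eq_div_iff hne,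
      hQeval]
    push_cast at h1 h2 ⊢
    linear_combination (ω : ℂ) * symJb μ b (2 * Real.pi * y) * h1
      + (symL γ μ a (2 * Real.pi * y) : ℂ) * h2
  · filter_upwards [hsol.eq_fst, hsol.eq_snd] with y h1 h2
    have hne : ((Q.eval |y| : ℝ) : ℂ) ≠ 0 := by exact_mod_cast (hQ _ (abs_nonneg y)).ne'
    rw [hsym, hsym, ejb, ejc, div_mul_eq_mul_div, div_mul_eq_mul_div, ← add_div, eq_div_iff hne,
      hQeval]
    push_cast at h1 h2 ⊢
    linear_combination (1 - γ : ℂ) * symJc μ c (2 * Real.pi * y) * h1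
      + (ω : ℂ) * symJb μ b (2 * Real.pi * y) * h2

end

end BFD

/-! ### Gaussian wave packets -/

namespace BFD

section

open Filter Topology

/-- The Gaussian of width `R` and height one. -/
noncomputable def gaussian (R x : ℝ) : ℝ := Real.exp (-Real.pi * x ^ 2 / R ^ 2)

/-- The odd wave packet of width `R` and height at most one, at the frequencies `± y₀`. -/
noncomputable def oddPacket (R y₀ x : ℝ) : ℝ := gaussian R x * Real.sin (2 * Real.pi * y₀ * x)

/-- The Fourier transform of `oddPacket R y₀`, up to the factor `-i`. -/
noncomputable def oddPacketHat (R y₀ y : ℝ) : ℝ :=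
  R / 2 * (Real.exp (-Real.pi * R ^ 2 * (y - y₀) ^ 2) - Real.exp (-Real.pi * R ^ 2 * (y + y₀) ^ 2))

theorem fourier_modulated_gaussian {R : ℝ} (hR : 0 < R) (c y : ℝ) :
    𝓕 (fun x : ℝ => (gaussian R x : ℂ) * Complex.exp (2 * Real.pi * Complex.I * c * x)) y
      = ((R * Real.exp (-Real.pi * R ^ 2 * (y - c) ^ 2) : ℝ) : ℂ) := by
  have hb : 0 < (((R ^ 2)⁻¹ : ℝ) : ℂ).re := by rw [Complex.ofReal_re]; positivity
  have h := congrFun (fourier_gaussian_pi' hb (Complex.I * c)) y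
  have e : (fun x : ℝ => (gaussian R x : ℂ) * Complex.exp (2 * Real.pi * Complex.I * c * x))
      = fun x : ℝ => Complex.exp (-Real.pi * (((R ^ 2)⁻¹ : ℝ) : ℂ) * x ^ 2
        + 2 * Real.pi * (Complex.I * c) * x) := by
    ext x
    rw [gaussian, Complex.ofReal_exp, ← Complex.exp_add]
    congr 1
    push_cast
    ring
  rw [e, h]
  have e2 : (((R ^ 2)⁻¹ : ℝ) : ℂ) ^ (1 / 2 : ℂ) = ((R⁻¹ : ℝ) : ℂ) := by
    rw [show (1 / 2 : ℂ) = ((1 / 2 : ℝ) : ℂ) by norm_num,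
      ← Complex.ofReal_cpow (by positivity), ← Real.sqrt_eq_rpow, Real.sqrt_inv,
      Real.sqrt_sq hR.le]
  have e3 : Complex.I * (Complex.I * (c : ℂ)) = -c := by
    rw [← mul_assoc, Complex.I_mul_I]; ring
  rw [e2, e3]
  push_cast
  have hR' : (R : ℂ) ≠ 0 := by exact_mod_cast hR.ne'
  congr 1
  · field_simp
  · congr 1
    field_simp
    ring

theorem continuous_gaussian (R : ℝ) : Continuous (gaussian R) := by
  unfold gaussian; fun_prop

theorem integrable_gaussian {R : ℝ} (hR : 0 < R) : Integrable (gaussian R) := by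
  refine (integrable_exp_neg_mul_sq (b := Real.pi / R ^ 2) (by positivity)).congr
    (.of_forall fun x => ?_)
  simp only [gaussian]
  congr 1
  ring

theorem gaussian_pos (R x : ℝ) : 0 < gaussian R x := Real.exp_pos _

theorem gaussian_le_one (R x : ℝ) : gaussian R x ≤ 1 := by
  refine Real.exp_le_one_iff.2 ?_
  rw [neg_mul, neg_div]
  exact neg_nonpos.2 (by positivity)

theorem continuous_oddPacket (R y₀ : ℝ) : Continuous (oddPacket R y₀) := by
  have := continuous_gaussian R
  unfold oddPacket; fun_prop

theorem abs_oddPacket_le (R y₀ x : ℝ) : |oddPacket R y₀ x| ≤ gaussian R x := by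
  rw [oddPacket, abs_mul, abs_of_pos (gaussian_pos R x)]
  exact mul_le_of_le_one_right (gaussian_pos R x).le (Real.abs_sin_le_one _)

theorem oddPacket_neg (R y₀ x : ℝ) : oddPacket R y₀ (-x) = -oddPacket R y₀ x := by
  simp [oddPacket, gaussian]

/-- The real part comes from the even summand and the imaginary part from the odd one. -/
theorem fourier_packet {R : ℝ} (hR : 0 < R) (y₀ p q y : ℝ) :
    𝓕 (cplx fun x => p * oddPacket R y₀ x + q * gaussian R x) y
      = ((q * (R * Real.exp (-Real.pi * R ^ 2 * y ^ 2)) : ℝ) : ℂ)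
        - ((p * oddPacketHat R y₀ y : ℝ) : ℂ) * Complex.I := by
  set e : ℝ → ℝ → ℂ := fun c x =>
    (gaussian R x : ℂ) * Complex.exp (2 * Real.pi * Complex.I * c * x) with he
  have hei : ∀ c, Integrable (e c) := fun c => by
    have := continuous_gaussian R
    refine (integrable_gaussian hR).mono' (by rw [he]; fun_prop) (.of_forall fun x => ?_)
    rw [he]
    simp only [norm_mul, Complex.norm_real, Real.norm_eq_abs, abs_of_pos (gaussian_pos R x)]
    rw [show 2 * (Real.pi : ℂ) * Complex.I * c * x = ((2 * Real.pi * c * x : ℝ) : ℂ) * Complex.I by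
      push_cast; ring, Complex.norm_exp_ofReal_mul_I, mul_one]
  have hf : (cplx fun x => p * oddPacket R y₀ x + q * gaussian R x)
      = fun x => (q : ℂ) * e 0 x + (-(p / 2) * Complex.I : ℂ) * (e y₀ x - e (-y₀) x) := by
    ext x
    have h1 : Complex.exp (2 * Real.pi * Complex.I * y₀ * x)
        = Complex.cos (2 * Real.pi * y₀ * x) + Complex.sin (2 * Real.pi * y₀ * x) * Complex.I := by
      rw [← Complex.exp_mul_I]; congr 1; ring
    have h2 : Complex.exp (2 * Real.pi * Complex.I * ((-y₀ : ℝ) : ℂ) * x)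
        = Complex.cos (2 * Real.pi * y₀ * x) - Complex.sin (2 * Real.pi * y₀ * x) * Complex.I := by
      rw [← Complex.cos_neg, ← neg_neg (Complex.sin (2 * Real.pi * y₀ * x)), ← Complex.sin_neg,
        neg_mul, sub_neg_eq_add, ← Complex.exp_mul_I]
      congr 1; push_cast; ring
    simp only [cplx, oddPacket, he, h1, h2]
    push_cast
    rw [show 2 * (Real.pi : ℂ) * Complex.I * 0 * x = 0 by ring, Complex.exp_zero]
    ring_nf
    rw [Complex.I_sq]
    ring
  have hF : ∀ c, 𝓕 (e c) y = ((R * Real.exp (-Real.pi * R ^ 2 * (y - c) ^ 2) : ℝ) : ℂ) :=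
    fun c => fourier_modulated_gaussian hR c y
  have hi : ∀ c, Integrable fun x => Real.fourierChar (-(x * y)) • e c x := fun c => by
    refine ((Real.fourierIntegral_convergent_iff y).2 (hei c)).congr (.of_forall fun x => ?_)
    simp [mul_comm]
  rw [hf, Real.fourier_real_eq]
  have hsplit : ∀ x : ℝ, Real.fourierChar (-(x * y)) •
      ((q : ℂ) * e 0 x + (-(p / 2) * Complex.I : ℂ) * (e y₀ x - e (-y₀) x))
      = (q : ℂ) * (Real.fourierChar (-(x * y)) • e 0 x) + (-(p / 2) * Complex.I : ℂ) *
        (Real.fourierChar (-(x * y)) • e y₀ x - Real.fourierChar (-(x * y)) • e (-y₀) x) := by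
    intro x
    simp only [Circle.smul_def, smul_eq_mul]
    ring
  simp_rw [hsplit]
  have hi₂ : Integrable fun x =>
      Real.fourierChar (-(x * y)) • e y₀ x - Real.fourierChar (-(x * y)) • e (-y₀) x :=
    (hi y₀).sub (hi (-y₀))
  rw [integral_add ((hi 0).const_mul _) (hi₂.const_mul _),
    integral_const_mul, integral_const_mul, integral_sub (hi y₀) (hi (-y₀)),
    ← Real.fourier_real_eq, ← Real.fourier_real_eq, ← Real.fourier_real_eq, hF, hF, hF,
    oddPacketHat, sub_zero, sub_neg_eq_add]
  push_cast
  ring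

theorem norm_sub_mul_I_sq (r s : ℝ) : ‖(r : ℂ) - (s : ℂ) * Complex.I‖ ^ 2 = r ^ 2 + s ^ 2 := by
  rw [← Complex.normSq_eq_norm_sq, Complex.normSq_apply]
  simp
  ring

theorem memLp_cplx_packet {R : ℝ} (hR : 0 < R) (y₀ p q : ℝ) :
    Integrable (cplx fun x => p * oddPacket R y₀ x + q * gaussian R x) ∧
    MemLp (cplx fun x => p * oddPacket R y₀ x + q * gaussian R x) 2 volume := by
  have h1 := continuous_gaussian R
  have h2 := continuous_oddPacket R y₀
  have hc : Continuous (cplx fun x => p * oddPacket R y₀ x + q * gaussian R x) :=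
    Complex.continuous_ofReal.comp (by fun_prop)
  have hb : ∀ x, ‖cplx (fun x => p * oddPacket R y₀ x + q * gaussian R x) x‖
      ≤ (|p| + |q|) * gaussian R x := fun x => by
    simp only [cplx, Complex.norm_real, Real.norm_eq_abs]
    refine (abs_add_le _ _).trans ?_
    rw [abs_mul, abs_mul, add_mul, abs_of_pos (gaussian_pos R x)]
    gcongr
    exact abs_oddPacket_le R y₀ x
  have hi := (integrable_gaussian hR).const_mul (|p| + |q|)
  refine ⟨hi.mono' hc.aestronglyMeasurable (.of_forall hb), ?_⟩
  rw [memLp_two_iff_integrable_sq_norm hc.aestronglyMeasurable]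
  refine (hi.const_mul (|p| + |q|)).mono' (by fun_prop) (.of_forall fun x => ?_)
  rw [Real.norm_of_nonneg (by positivity), sq]
  refine mul_le_mul ?_ (hb x) (norm_nonneg _) (by positivity)
  exact (hb x).trans (mul_le_of_le_one_right (by positivity) (gaussian_le_one R x))

theorem oddPacketHat_sq_le (R y₀ y : ℝ) : oddPacketHat R y₀ y ^ 2 ≤ R ^ 2 / 2 *
    (Real.exp (-Real.pi * R ^ 2 * (y - y₀) ^ 2) ^ 2
      + Real.exp (-Real.pi * R ^ 2 * (y + y₀) ^ 2) ^ 2) := by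
  rw [oddPacketHat, mul_pow]
  set s := Real.exp (-Real.pi * R ^ 2 * (y - y₀) ^ 2)
  set t := Real.exp (-Real.pi * R ^ 2 * (y + y₀) ^ 2)
  nlinarith [mul_nonneg (sq_nonneg R) (sq_nonneg (s + t))]

theorem integrable_one_add_sq_mul_exp_sq {R : ℝ} (hR : 0 < R) (c : ℝ) :
    Integrable fun y : ℝ => (1 + y ^ 2) * Real.exp (-Real.pi * R ^ 2 * (y - c) ^ 2) ^ 2 := by
  have hb : 0 < 2 * Real.pi * R ^ 2 := by positivity
  have h1 := integrable_exp_neg_mul_sq hb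
  have h2 := integrable_rpow_mul_exp_neg_mul_sq hb (s := 2) (by norm_num)
  have h3 := ((h1.add h2).const_mul (2 * (1 + c ^ 2))).comp_sub_right c
  refine h3.mono' (by fun_prop) (.of_forall fun y => ?_)
  rw [Real.norm_of_nonneg (by positivity), ← Real.exp_nat_mul]
  simp only [Pi.add_apply]
  rw [show ((2 : ℕ) : ℝ) * (-Real.pi * R ^ 2 * (y - c) ^ 2) = -(2 * Real.pi * R ^ 2) * (y - c) ^ 2 by
    push_cast; ring, show (y - c) ^ (2 : ℝ) = (y - c) ^ 2 by exact_mod_cast Real.rpow_natCast _ 2]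
  have : 1 + y ^ 2 ≤ 2 * (1 + c ^ 2) * (1 + (y - c) ^ 2) := by
    nlinarith [sq_nonneg (y - c - c), sq_nonneg (c * (y - c))]
  calc _ ≤ 2 * (1 + c ^ 2) * (1 + (y - c) ^ 2) * Real.exp (-(2 * Real.pi * R ^ 2) * (y - c) ^ 2) := by
        gcongr
    _ = _ := by ring

theorem memHs_one_packet {R : ℝ} (hR : 0 < R) (y₀ p q : ℝ) :
    MemHs 1 fun x => p * oddPacket R y₀ x + q * gaussian R x := by
  obtain ⟨hi, h2⟩ := memLp_cplx_packet hR y₀ p q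
  refine memHs_iff.2 ⟨h2, ?_⟩
  have hF := fourierL2_ae_eq hi h2
  have hFc := continuous_fourier hi
  have hwc : Continuous fun y : ℝ => (((1 + y ^ 2) ^ ((1 : ℝ) / 2) : ℝ) : ℂ) :=
    Complex.continuous_ofReal.comp ((by fun_prop : Continuous fun y : ℝ => 1 + y ^ 2).rpow_const
      fun y => Or.inl (by positivity))
  have hL : MemLp (fun y => (((1 + y ^ 2) ^ ((1 : ℝ) / 2) : ℝ) : ℂ) *
      𝓕 (cplx fun x => p * oddPacket R y₀ x + q * gaussian R x) y) 2 volume := by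
    rw [memLp_two_iff_integrable_sq_norm (by fun_prop)]
    have i₀ := integrable_one_add_sq_mul_exp_sq hR 0
    have i₁ := integrable_one_add_sq_mul_exp_sq hR y₀
    have i₂ := integrable_one_add_sq_mul_exp_sq hR (-y₀)
    simp only [sub_neg_eq_add, sub_zero] at i₀ i₂
    refine ((i₀.const_mul (q ^ 2 * R ^ 2)).add
      ((i₁.add i₂).const_mul (p ^ 2 * (R ^ 2 / 2)))).mono' (by fun_prop) (.of_forall fun y => ?_)
    rw [Real.norm_of_nonneg (by positivity), norm_mul, mul_pow, fourier_packet hR,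
      norm_sub_mul_I_sq, Complex.norm_real, Real.norm_eq_abs, sq_abs,
      ← Real.sqrt_eq_rpow, Real.sq_sqrt (by positivity)]
    simp only [Pi.add_apply]
    have := mul_le_mul_of_nonneg_left (oddPacketHat_sq_le R y₀ y)
      (by positivity : 0 ≤ (1 + y ^ 2) * p ^ 2)
    nlinarith
  refine (memLp_congr_ae ?_).2 hL
  filter_upwards [hF] with y hy
  rw [hy]

theorem integral_packet_sq (R : ℝ) (hR : 0 < R) (y₀ : ℝ) :
    ∫ y, oddPacketHat R y₀ y ^ 2 = ∫ x, oddPacket R y₀ x ^ 2 := by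
  obtain ⟨hi, h2⟩ := memLp_cplx_packet hR y₀ 1 0
  have hF := fourierL2_ae_eq hi h2
  have h := integral_norm_fourierL2_sq h2
  simp only [one_mul, zero_mul, add_zero] at h hF
  rw [← h]
  refine integral_congr_ae ?_
  filter_upwards [hF] with y hy
  have h3 := fourier_packet hR y₀ 1 0 y
  simp only [one_mul, zero_mul, add_zero] at h3
  rw [hy, h3, norm_sub_mul_I_sq]
  ring

end

end BFD

/-! ### Estimates for wave packets -/

namespace BFD

section

open Filter Topology

theorem integral_gaussian_mul_cos {R : ℝ} (hR : 0 < R) (c : ℝ) :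
    ∫ x, gaussian R x * Real.cos (2 * Real.pi * c * x) = R * Real.exp (-Real.pi * R ^ 2 * c ^ 2) := by
  have h := fourier_modulated_gaussian hR c 0
  rw [Real.fourier_real_eq] at h
  have hi : Integrable fun x : ℝ =>
      (gaussian R x : ℂ) * Complex.exp (2 * Real.pi * Complex.I * c * x) := by
    have := continuous_gaussian R
    refine (integrable_gaussian hR).mono' (by fun_prop) (.of_forall fun x => ?_)
    simp only [norm_mul, Complex.norm_real, Real.norm_eq_abs, abs_of_pos (gaussian_pos R x)]
    rw [show 2 * (Real.pi : ℂ) * Complex.I * c * x = ((2 * Real.pi * c * x : ℝ) : ℂ) * Complex.I by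
      push_cast; ring, Complex.norm_exp_ofReal_mul_I, mul_one]
  simp only [mul_zero, neg_zero, AddChar.map_zero_eq_one, one_smul] at h
  have h2 := congrArg Complex.re h
  rw [Complex.ofReal_re, zero_sub, neg_sq] at h2
  rw [← h2]
  have h3 := integral_re (𝕜 := ℂ) hi
  simp only [RCLike.re_to_complex] at h3
  rw [← h3]
  refine integral_congr_ae (.of_forall fun x => ?_)
  simp only
  rw [Complex.re_ofReal_mul,
    show 2 * (Real.pi : ℂ) * Complex.I * c * x = ((2 * Real.pi * c * x : ℝ) : ℂ) * Complex.I by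
      push_cast; ring, Complex.exp_ofReal_mul_I_re]

theorem integral_exp_neg_pi_mul {R : ℝ} (hR : 0 < R) (c : ℝ) :
    (Integrable fun y : ℝ => Real.exp (-Real.pi * R ^ 2 * (y - c) ^ 2)) ∧
    ∫ y : ℝ, Real.exp (-Real.pi * R ^ 2 * (y - c) ^ 2) = 1 / R := by
  have hb : 0 < Real.pi * R ^ 2 := by positivity
  have h1 := integrable_exp_neg_mul_sq hb
  have h2 := integral_gaussian (Real.pi * R ^ 2)
  rw [show Real.pi / (Real.pi * R ^ 2) = (1 / R) ^ 2 by field_simp,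
    Real.sqrt_sq (by positivity)] at h2
  simp only [neg_mul] at h1 h2 ⊢
  refine ⟨h1.comp_sub_right c, ?_⟩
  rw [← h2]
  exact integral_sub_right_eq_self (fun y : ℝ => Real.exp (-(Real.pi * R ^ 2 * y ^ 2))) c

/-- Second-harmonic resonance: `∫ u w²` grows linearly with the width of the packet. -/
theorem div_eight_le_integral_gaussian_mul_oddPacket_sq {R y₀ : ℝ} (hR : 0 < R)
    (hRy : 1 ≤ R * y₀) : R / 8 ≤ ∫ x, gaussian R x * oddPacket R y₀ x ^ 2 := by
  set r := R / √3 with hr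
  have h3 : 0 < √(3 : ℝ) := by positivity
  have h32 : √(3 : ℝ) ^ 2 = 3 := Real.sq_sqrt (by norm_num)
  have hr0 : 0 < r := by positivity
  have e : ∀ x, gaussian R x * oddPacket R y₀ x ^ 2
      = 1 / 2 * (gaussian r x * Real.cos (2 * Real.pi * 0 * x)
        - gaussian r x * Real.cos (2 * Real.pi * (2 * y₀) * x)) := by
    intro x
    have h1 : gaussian R x ^ 3 = gaussian r x := by
      rw [gaussian, gaussian, ← Real.exp_nat_mul, hr, div_pow, h32]
      congr 1
      push_cast
      field_simp
    rw [← h1, oddPacket, show 2 * Real.pi * (2 * y₀) * x = 2 * (2 * Real.pi * y₀ * x) by ring,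
      Real.cos_two_mul, show 2 * Real.pi * 0 * x = 0 by ring, Real.cos_zero]
    have := Real.sin_sq_add_cos_sq (2 * Real.pi * y₀ * x)
    linear_combination (gaussian R x ^ 3) * this
  have hi : ∀ c, Integrable fun x => gaussian r x * Real.cos (2 * Real.pi * c * x) := fun c =>
    (integrable_gaussian hr0).mul_bdd (c := 1) (by fun_prop)
      (.of_forall fun x => by simpa using Real.abs_cos_le_one _)
  simp_rw [e]
  rw [integral_const_mul, integral_sub (hi 0) (hi _), integral_gaussian_mul_cos hr0,
    integral_gaussian_mul_cos hr0]
  -- `gaussian R ^ 3 = gaussian r`, so the oscillating part is of relative size at most `1 / 2`.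
  have hexp : Real.exp (-Real.pi * r ^ 2 * (2 * y₀) ^ 2) ≤ 1 / 2 := by
    have h1 : -Real.pi * r ^ 2 * (2 * y₀) ^ 2 ≤ -1 := by
      have : r ^ 2 * (2 * y₀) ^ 2 = 4 / 3 * (R * y₀) ^ 2 := by rw [hr, div_pow, h32]; ring
      have h4 : 1 ≤ (R * y₀) ^ 2 := one_le_pow₀ hRy
      have := Real.pi_gt_three
      nlinarith
    refine (Real.exp_le_exp.2 h1).trans ?_
    rw [Real.exp_neg, one_div]
    exact inv_anti₀ (by norm_num) (by have := Real.add_one_le_exp (1 : ℝ); linarith)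
  have hrR : R / 2 ≤ r := by
    rw [hr]
    refine div_le_div_of_nonneg_left hR.le h3 ?_
    exact (Real.sqrt_le_left (by norm_num)).2 (by norm_num)
  have h0 : Real.exp (-Real.pi * r ^ 2 * 0 ^ 2) = 1 := by simp
  rw [h0]
  nlinarith

theorem mul_exp_sq_le {R : ℝ} (hR : 1 ≤ R) (z : ℝ) :
    (|z| + z ^ 2) * Real.exp (-Real.pi * R ^ 2 * z ^ 2) ^ 2
      ≤ 2 / R * Real.exp (-Real.pi * R ^ 2 * z ^ 2) ∧
    (1 + z ^ 2) * Real.exp (-Real.pi * R ^ 2 * z ^ 2) ^ 2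
      ≤ 2 * Real.exp (-Real.pi * R ^ 2 * z ^ 2) := by
  have hR0 : 0 < R := by linarith
  set E := Real.exp (-Real.pi * R ^ 2 * z ^ 2) with hE
  have hE0 : 0 < E := Real.exp_pos _
  have hE1 : (1 + (R * |z|) ^ 2) * E ≤ 1 := by
    rw [hE, neg_mul, neg_mul, Real.exp_neg, ← div_eq_mul_inv, div_le_one (Real.exp_pos _)]
    refine le_trans ?_ (Real.add_one_le_exp _)
    have : 0 ≤ (R * |z|) ^ 2 := by positivity
    have h3 := Real.pi_gt_three
    rw [mul_pow, sq_abs] at this ⊢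
    nlinarith
  have hz : |z| * E ≤ 1 / R := by
    rw [le_div_iff₀ hR0]
    nlinarith [sq_nonneg (R * |z| - 1)]
  have hz2 : z ^ 2 * E ≤ 1 / R := by
    rw [le_div_iff₀ hR0]
    have h1 : z ^ 2 * R ≤ (R * |z|) ^ 2 := by
      rw [mul_pow, sq_abs]
      nlinarith [sq_nonneg z, mul_nonneg (sq_nonneg z) (mul_nonneg hR0.le (sub_nonneg.2 hR))]
    nlinarith
  have hR1 : 1 / R ≤ 1 := by rw [div_le_one hR0]; exact hR
  have hE2 : E ≤ 1 := by nlinarith [sq_nonneg (R * |z|)]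
  constructor
  · rw [show 2 / R = 1 / R + 1 / R by ring, sq E, ← mul_assoc, add_mul]
    exact mul_le_mul_of_nonneg_right (add_le_add hz hz2) hE0.le
  · rw [sq E, ← mul_assoc, add_mul]
    refine mul_le_mul_of_nonneg_right ?_ hE0.le
    linarith

/-- The quadratic form of `E` on a pair `(α W, W)`, at the frequency `θ`. -/
noncomputable def pairSymbol (γ μ a b c ω α θ : ℝ) : ℝ :=
  (1 - γ) / 2 * α ^ 2 * symJc μ c θ + 1 / 2 * symL γ μ a θ - ω * α * symJb μ b θ

theorem pairSymbol_le (γ μ a b c ω α θ₀ : ℝ) (hθ : 0 ≤ θ₀) :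
    ∃ K, 0 ≤ K ∧ ∀ θ, pairSymbol γ μ a b c ω α θ ≤ pairSymbol γ μ a b c ω α θ₀
      + K * (|(|θ| - θ₀)| + (|θ| - θ₀) ^ 2) := by
  set k₁ := -(1 / 2) * (√μ / γ ^ 2) with hk₁
  set k₂ := -((1 - γ) / 2) * α ^ 2 * (μ * c) - 1 / 2 * (μ / γ * (a - 1 / γ ^ 2))
    - ω * α * (μ * b) with hk₂
  refine ⟨|k₁| + 2 * θ₀ * |k₂| + |k₂|, by positivity, fun θ => ?_⟩
  have e : pairSymbol γ μ a b c ω α θ = pairSymbol γ μ a b c ω α θ₀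
      + (k₁ + 2 * θ₀ * k₂) * (|θ| - θ₀) + k₂ * (|θ| - θ₀) ^ 2 := by
    simp only [pairSymbol, symJc, symL, symJb, ← sq_abs θ, abs_of_nonneg hθ, hk₁, hk₂]
    ring
  rw [e]
  have h1 : (k₁ + 2 * θ₀ * k₂) * (|θ| - θ₀) ≤ (|k₁| + 2 * θ₀ * |k₂|) * |(|θ| - θ₀)| := by
    refine (le_abs_self _).trans ?_
    rw [abs_mul]
    gcongr
    refine (abs_add_le _ _).trans ?_
    rw [abs_mul (2 * θ₀), abs_of_nonneg (by positivity : 0 ≤ 2 * θ₀)]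
  have h2 : k₂ * (|θ| - θ₀) ^ 2 ≤ |k₂| * (|θ| - θ₀) ^ 2 := by
    gcongr; exact le_abs_self _
  have h3 : 0 ≤ |k₂| * |(|θ| - θ₀)| := by positivity
  have h4 : 0 ≤ (|k₁| + 2 * θ₀ * |k₂|) * (|θ| - θ₀) ^ 2 := by positivity
  linarith

theorem pairSymbol_mul_oddPacketHat_sq_le (γ μ a b c ω α : ℝ) {y₀ : ℝ} (hy₀ : 0 < y₀) :
    ∃ K, 0 ≤ K ∧ ∀ R, 1 ≤ R → ∀ y,
      pairSymbol γ μ a b c ω α (2 * Real.pi * y) * oddPacketHat R y₀ y ^ 2 ≤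
        pairSymbol γ μ a b c ω α (2 * Real.pi * y₀) * oddPacketHat R y₀ y ^ 2
        + K * R * (Real.exp (-Real.pi * R ^ 2 * (y - y₀) ^ 2)
          + Real.exp (-Real.pi * R ^ 2 * (y + y₀) ^ 2)) := by
  obtain ⟨K, hK, h⟩ := pairSymbol_le γ μ a b c ω α (2 * Real.pi * y₀) (by positivity)
  set k := 2 * Real.pi + (2 * Real.pi) ^ 2 with hk
  have hk0 : 0 ≤ k := by positivity
  refine ⟨K * k, by positivity, fun R hR y => ?_⟩
  have hR0 : 0 < R := by linarith
  have hd : |(|2 * Real.pi * y| - 2 * Real.pi * y₀)| + (|2 * Real.pi * y| - 2 * Real.pi * y₀) ^ 2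
      ≤ k * (|(|y| - y₀)| + (|y| - y₀) ^ 2) := by
    rw [abs_mul, abs_of_pos Real.two_pi_pos, ← mul_sub, abs_mul, abs_of_pos Real.two_pi_pos, hk]
    have h1 := abs_nonneg (|y| - y₀)
    have h2 := sq_nonneg (|y| - y₀)
    have := Real.pi_pos
    have h3 : 0 ≤ Real.pi * (|y| - y₀) ^ 2 := by positivity
    have h4 : 0 ≤ Real.pi ^ 2 * |(|y| - y₀)| := by positivity
    nlinarith
  set E₁ := Real.exp (-Real.pi * R ^ 2 * (y - y₀) ^ 2) with hE₁
  set E₂ := Real.exp (-Real.pi * R ^ 2 * (y + y₀) ^ 2) with hE₂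
  have a1 : |(|y| - y₀)| ≤ |y - y₀| := by
    have := abs_abs_sub_abs_le_abs_sub y y₀
    rwa [abs_of_pos hy₀] at this
  have a2 : |(|y| - y₀)| ≤ |y + y₀| := by
    have := abs_abs_sub_abs_le_abs_sub y (-y₀)
    rwa [abs_neg, abs_of_pos hy₀, sub_neg_eq_add] at this
  have b1 : (|(|y| - y₀)| + (|y| - y₀) ^ 2) * E₁ ^ 2 ≤ 2 / R * E₁ := by
    refine le_trans ?_ (mul_exp_sq_le hR (y - y₀)).1
    refine mul_le_mul_of_nonneg_right (add_le_add a1 (sq_le_sq.2 a1)) (by positivity)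
  have b2 : (|(|y| - y₀)| + (|y| - y₀) ^ 2) * E₂ ^ 2 ≤ 2 / R * E₂ := by
    refine le_trans ?_ (mul_exp_sq_le hR (y + y₀)).1
    refine mul_le_mul_of_nonneg_right (add_le_add a2 (sq_le_sq.2 a2)) (by positivity)
  have hW := oddPacketHat_sq_le R y₀ y
  rw [← hE₁, ← hE₂] at hW
  set W := oddPacketHat R y₀ y ^ 2 with hWdef
  have hW0 : 0 ≤ W := sq_nonneg _
  set d := |(|y| - y₀)| + (|y| - y₀) ^ 2 with hdd
  have hd0 : 0 ≤ d := by positivity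
  have hdW : d * W ≤ R * (E₁ + E₂) := by
    calc d * W ≤ d * (R ^ 2 / 2 * (E₁ ^ 2 + E₂ ^ 2)) := by gcongr
      _ = R ^ 2 / 2 * (d * E₁ ^ 2 + d * E₂ ^ 2) := by ring
      _ ≤ R ^ 2 / 2 * (2 / R * E₁ + 2 / R * E₂) := by gcongr
      _ = R * (E₁ + E₂) := by field_simp
  have h1 := mul_le_mul_of_nonneg_right ((h (2 * Real.pi * y)).trans
    (add_le_add_right (mul_le_mul_of_nonneg_left hd hK) _)) hW0
  have h2 := mul_le_mul_of_nonneg_left hdW (mul_nonneg hK hk0)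
  linarith

theorem symJc_mul_exp_sq_le {γ μ c : ℝ} (hγ1 : γ < 1) :
    ∃ K, 0 ≤ K ∧ ∀ R, 1 ≤ R → ∀ y, (1 - γ) / 2 * symJc μ c (2 * Real.pi * y)
      * (R * Real.exp (-Real.pi * R ^ 2 * y ^ 2)) ^ 2
        ≤ K * R ^ 2 * Real.exp (-Real.pi * R ^ 2 * y ^ 2) := by
  set k := 1 + |μ * c| * (2 * Real.pi) ^ 2 with hk
  have hγ : 0 ≤ (1 - γ) / 2 := by linarith
  refine ⟨(1 - γ) / 2 * k * 2, by positivity, fun R hR y => ?_⟩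
  have h1 : symJc μ c (2 * Real.pi * y) ≤ k * (1 + y ^ 2) := by
    rw [symJc, hk, mul_pow, ← mul_assoc]
    have h2 : -(μ * c) * ((2 * Real.pi) ^ 2 * y ^ 2) ≤ |μ * c| * ((2 * Real.pi) ^ 2 * y ^ 2) := by
      gcongr; exact neg_le_abs _
    have h3 : 0 ≤ |μ * c| * (2 * Real.pi) ^ 2 := by positivity
    nlinarith [sq_nonneg y]
  have h2 := (mul_exp_sq_le hR y).2
  set E := Real.exp (-Real.pi * R ^ 2 * y ^ 2)
  calc _ ≤ (1 - γ) / 2 * (k * (1 + y ^ 2)) * (R * E) ^ 2 := by gcongr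
    _ = (1 - γ) / 2 * k * R ^ 2 * ((1 + y ^ 2) * E ^ 2) := by ring
    _ ≤ (1 - γ) / 2 * k * R ^ 2 * (2 * E) := by gcongr
    _ = _ := by ring

end

end BFD

/-! ### Minimizers and positivity of the symbol -/

namespace BFD

section

open Filter Topology

/-- The density of the quadratic form `E` on the Fourier side. -/
noncomputable def energyDensity (γ μ a b c ω : ℝ) (X Y : ℝ → ℂ) (y : ℝ) : ℝ :=
  (1 - γ) / 2 * symJc μ c (2 * Real.pi * y) * ‖X y‖ ^ 2
    + 1 / 2 * symL γ μ a (2 * Real.pi * y) * ‖Y y‖ ^ 2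
    - ω * symJb μ b (2 * Real.pi * y) * (X y * (starRingEnd ℂ) (Y y)).re

theorem abs_quadratic_le (k₀ k₁ k₂ : ℝ) :
    ∃ C, 0 ≤ C ∧ ∀ y : ℝ, |k₀ + k₁ * |2 * Real.pi * y| + k₂ * (2 * Real.pi * y) ^ 2|
      ≤ C * (1 + y ^ 2) := by
  refine ⟨|k₀| + |k₁| * (2 * Real.pi) + |k₂| * (2 * Real.pi) ^ 2, by positivity, fun y => ?_⟩
  have h : |k₀ + k₁ * |2 * Real.pi * y| + k₂ * (2 * Real.pi * y) ^ 2|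
      ≤ |k₀| + |k₁| * (2 * Real.pi) * |y| + |k₂| * (2 * Real.pi) ^ 2 * y ^ 2 := by
    refine (abs_add_le _ _).trans (add_le_add ((abs_add_le _ _).trans_eq ?_) (le_of_eq ?_))
    · rw [abs_mul k₁, abs_abs, abs_mul, abs_of_pos Real.two_pi_pos, ← mul_assoc]
    · rw [abs_mul, mul_pow, abs_of_nonneg (by positivity : 0 ≤ (2 * Real.pi) ^ 2 * y ^ 2), mul_assoc]
  refine h.trans ?_
  have h1 : |y| ≤ 1 + y ^ 2 := by rw [← sq_abs y]; nlinarith [sq_nonneg (|y| - 1), abs_nonneg y]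
  have h2 : 0 ≤ |k₁| * (2 * Real.pi) := by positivity
  have h3 : 0 ≤ |k₂| * (2 * Real.pi) ^ 2 := by positivity
  have h4 := mul_le_mul_of_nonneg_left h1 h2
  nlinarith [mul_nonneg (abs_nonneg k₀) (sq_nonneg y)]

theorem integrable_energyDensity (γ μ a b c ω : ℝ) {f g : ℝ → ℝ} (hf : MemHs 1 f)
    (hg : MemHs 1 g) :
    Integrable (energyDensity γ μ a b c ω (fourierL2 f) (fourierL2 g)) := by
  have hw : ∀ {h : ℝ → ℝ}, MemHs 1 h → Integrable fun y => (1 + y ^ 2) * ‖fourierL2 h y‖ ^ 2 := by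
    intro h hh
    have h2 := (memHs_iff.1 hh).2
    rw [memLp_two_iff_integrable_sq_norm h2.1] at h2
    refine h2.congr (.of_forall fun y => ?_)
    simp only [norm_mul, mul_pow, Complex.norm_real, Real.norm_eq_abs, sq_abs]
    rw [← Real.sqrt_eq_rpow, Real.sq_sqrt (by positivity)]
  have hmf := (memLp_fourierL2 f).1
  have hmg := (memLp_fourierL2 g).1
  have hquad : ∀ {F : ℝ → ℝ}, AEStronglyMeasurable F volume →
      (Integrable fun y => (1 + y ^ 2) * F y) → ∀ {p : ℝ → ℝ} {k₀ k₁ k₂ : ℝ},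
      (∀ y, p y = k₀ + k₁ * |2 * Real.pi * y| + k₂ * (2 * Real.pi * y) ^ 2) →
      Integrable fun y => p y * F y := by
    intro F hF hi p k₀ k₁ k₂ hp
    obtain ⟨C, hC, h⟩ := abs_quadratic_le k₀ k₁ k₂
    have hpc : Continuous p := by rw [funext hp]; fun_prop
    refine (hi.norm.const_mul C).mono' (hpc.aestronglyMeasurable.mul hF) (.of_forall fun y => ?_)
    rw [Real.norm_eq_abs, Real.norm_eq_abs, abs_mul, abs_mul,
      abs_of_pos (by positivity : 0 < 1 + y ^ 2), ← mul_assoc, hp]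
    exact mul_le_mul_of_nonneg_right (h y) (abs_nonneg _)
  have hre : Integrable fun y =>
      (1 + y ^ 2) * (fourierL2 f y * (starRingEnd ℂ) (fourierL2 g y)).re := by
    refine ((hw hf).add (hw hg)).mono' ?_ (.of_forall fun y => ?_)
    · refine AEStronglyMeasurable.mul (by fun_prop) ?_
      exact Complex.continuous_re.comp_aestronglyMeasurable
        (hmf.mul (Complex.continuous_conj.comp_aestronglyMeasurable hmg))
    · rw [Real.norm_eq_abs, abs_mul, abs_of_pos (by positivity : 0 < 1 + y ^ 2)]
      simp only [Pi.add_apply]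
      rw [← mul_add]
      refine mul_le_mul_of_nonneg_left ?_ (by positivity)
      refine (Complex.abs_re_le_norm _).trans ?_
      rw [norm_mul, RCLike.norm_conj]
      nlinarith [sq_nonneg (‖fourierL2 f y‖ - ‖fourierL2 g y‖), sq_nonneg ‖fourierL2 f y‖,
        sq_nonneg ‖fourierL2 g y‖]
  refine ((hquad (hmf.norm.pow 2) (hw hf) (k₀ := (1 - γ) / 2) (k₁ := 0)
    (k₂ := -((1 - γ) / 2) * (μ * c)) fun y => ?_).add
    (hquad (hmg.norm.pow 2) (hw hg) (k₀ := 1 / 2 * (1 / γ)) (k₁ := -(1 / 2) * (√μ / γ ^ 2))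
      (k₂ := -(1 / 2) * (μ / γ * (a - 1 / γ ^ 2))) fun y => ?_)).sub
    (hquad (Complex.continuous_re.comp_aestronglyMeasurable
        (hmf.mul (Complex.continuous_conj.comp_aestronglyMeasurable hmg))) hre (k₀ := ω)
        (k₁ := 0) (k₂ := ω * (μ * b)) fun y => ?_)
  · simp only [symJc]; ring
  · simp only [symL]; ring
  · simp only [symJb]; ring

theorem integral_of_odd {f : ℝ → ℝ} (h : ∀ x, f (-x) = -f x) : ∫ x, f x = 0 := by
  have := integral_neg_eq_self f volume
  simp only [h, integral_neg] at this
  linarith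

theorem constraintF_packet (γ ε : ℝ) {R : ℝ} (hR : 0 < R) (y₀ p q r : ℝ) :
    constraintF γ ε (fun x => p * oddPacket R y₀ x + q * gaussian R x)
      (fun x => r * oddPacket R y₀ x + 0 * gaussian R x)
      = ε / (2 * γ) * (r ^ 2 * q * ∫ x, gaussian R x * oddPacket R y₀ x ^ 2) := by
  have hw := continuous_oddPacket R y₀
  have hu := continuous_gaussian R
  have hb : ∀ x, |oddPacket R y₀ x ^ 2| ≤ 1 := fun x => by
    rw [abs_pow]
    exact pow_le_one₀ (abs_nonneg _) ((abs_oddPacket_le R y₀ x).trans (gaussian_le_one R x))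
  have hi2 : Integrable fun x => gaussian R x * oddPacket R y₀ x ^ 2 :=
    (integrable_gaussian hR).mul_bdd (c := 1) (by fun_prop) (.of_forall hb)
  have hi3 : Integrable fun x => oddPacket R y₀ x ^ 3 := by
    have h1 : Integrable (oddPacket R y₀) :=
      (integrable_gaussian hR).mono' hw.aestronglyMeasurable
        (.of_forall (abs_oddPacket_le R y₀))
    refine (h1.mul_bdd (c := 1) (by fun_prop) (.of_forall hb)).congr (.of_forall fun x => ?_)
    simp only
    ring
  have hodd : ∫ x, oddPacket R y₀ x ^ 3 = 0 := integral_of_odd fun x => by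
    rw [oddPacket_neg]; ring
  have e : ∀ x, (p * oddPacket R y₀ x + q * gaussian R x) *
      (r * oddPacket R y₀ x + 0 * gaussian R x) ^ 2
      = p * r ^ 2 * oddPacket R y₀ x ^ 3
        + r ^ 2 * q * (gaussian R x * oddPacket R y₀ x ^ 2) := fun x => by ring
  simp only [constraintF, e]
  rw [integral_add (hi3.const_mul _) (hi2.const_mul _), integral_const_mul, integral_const_mul,
    hodd]
  ring

/-- The energy of `(α A w + q u, A w)`. As `w` is odd and `u` is even there are no cross terms;
the first part is governed by the value of the symbol at the frequency of the packet. -/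
theorem energyE_packet_le {γ : ℝ} (μ a b c ω α : ℝ) {y₀ : ℝ} (hγ1 : γ < 1) (hy₀ : 0 < y₀)
    (hP : pairSymbol γ μ a b c ω α (2 * Real.pi * y₀) ≤ 0) :
    ∃ K, 0 ≤ K ∧ ∀ R, 1 ≤ R → 1 ≤ R * y₀ → ∀ A q : ℝ,
      energyE γ μ a b c ω (fun x => α * A * oddPacket R y₀ x + q * gaussian R x)
        (fun x => A * oddPacket R y₀ x + 0 * gaussian R x)
      ≤ A ^ 2 * (pairSymbol γ μ a b c ω α (2 * Real.pi * y₀) * (R / 8) + K) + K * (q ^ 2 * R) := by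
  obtain ⟨K₁, hK₁, h₁⟩ := pairSymbol_mul_oddPacketHat_sq_le γ μ a b c ω α hy₀
  obtain ⟨K₂, hK₂, h₂⟩ := symJc_mul_exp_sq_le (μ := μ) (c := c) hγ1
  refine ⟨2 * K₁ + K₂, by positivity, fun R hR hRy A q => ?_⟩
  have hR0 : 0 < R := by linarith
  set P := pairSymbol γ μ a b c ω α (2 * Real.pi * y₀) with hPdef
  obtain ⟨i₀, j₀⟩ := integral_exp_neg_pi_mul hR0 0
  obtain ⟨i₁, j₁⟩ := integral_exp_neg_pi_mul hR0 y₀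
  obtain ⟨i₂, j₂⟩ := integral_exp_neg_pi_mul hR0 (-y₀)
  simp only [sub_neg_eq_add, sub_zero] at i₀ j₀ i₂ j₂
  have hWi : Integrable fun y => oddPacketHat R y₀ y ^ 2 := by
    obtain ⟨hi, h2⟩ := memLp_cplx_packet hR0 y₀ 1 0
    have hF := fourierL2_ae_eq hi h2
    have h3 := (memLp_two_iff_integrable_sq_norm (memLp_fourierL2 _).1).1 (memLp_fourierL2
      fun x => 1 * oddPacket R y₀ x + 0 * gaussian R x)
    refine h3.congr ?_
    filter_upwards [hF] with y hy
    rw [hy, fourier_packet hR0, norm_sub_mul_I_sq]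
    ring
  have hdens := integrable_energyDensity γ μ a b c ω (memHs_one_packet hR0 y₀ (α * A) q)
    (memHs_one_packet hR0 y₀ A 0)
  have i₁₂ : Integrable fun y : ℝ => Real.exp (-Real.pi * R ^ 2 * (y - y₀) ^ 2)
      + Real.exp (-Real.pi * R ^ 2 * (y + y₀) ^ 2) := i₁.add i₂
  have hEi : Integrable fun y => A ^ 2 * (P * oddPacketHat R y₀ y ^ 2
      + K₁ * R * (Real.exp (-Real.pi * R ^ 2 * (y - y₀) ^ 2)
        + Real.exp (-Real.pi * R ^ 2 * (y + y₀) ^ 2))) :=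
    ((hWi.const_mul P).add (i₁₂.const_mul _)).const_mul _
  have hle : energyE γ μ a b c ω (fun x => α * A * oddPacket R y₀ x + q * gaussian R x)
        (fun x => A * oddPacket R y₀ x + 0 * gaussian R x)
      ≤ ∫ y, (A ^ 2 * (P * oddPacketHat R y₀ y ^ 2
        + K₁ * R * (Real.exp (-Real.pi * R ^ 2 * (y - y₀) ^ 2)
          + Real.exp (-Real.pi * R ^ 2 * (y + y₀) ^ 2)))
        + q ^ 2 * K₂ * R ^ 2 * Real.exp (-Real.pi * R ^ 2 * y ^ 2)) := by
    refine integral_mono_ae hdens (hEi.add (i₀.const_mul _)) ?_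
    obtain ⟨m₁, n₁⟩ := memLp_cplx_packet hR0 y₀ (α * A) q
    obtain ⟨m₂, n₂⟩ := memLp_cplx_packet hR0 y₀ A 0
    filter_upwards [fourierL2_ae_eq m₁ n₁, fourierL2_ae_eq m₂ n₂] with y hf hg
    have hre : ∀ r s t : ℝ, (((r : ℂ) - (s : ℂ) * Complex.I) *
        (starRingEnd ℂ) (((0 : ℝ) : ℂ) - (t : ℂ) * Complex.I)).re = s * t := by
      intro r s t
      simp
    rw [hf, hg, fourier_packet hR0, fourier_packet hR0, zero_mul, hre, norm_sub_mul_I_sq,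
      norm_sub_mul_I_sq]
    have e₁ := mul_le_mul_of_nonneg_left (h₁ R hR y) (sq_nonneg A)
    have e₂ := mul_le_mul_of_nonneg_left (h₂ R hR y) (sq_nonneg q)
    simp only [pairSymbol] at e₁
    linarith
  refine hle.trans ?_
  rw [integral_add hEi (i₀.const_mul _), integral_const_mul,
    integral_add (hWi.const_mul P) (i₁₂.const_mul _), integral_const_mul,
    integral_const_mul, integral_const_mul, integral_add i₁ i₂, j₀, j₁, j₂,
    integral_packet_sq R hR0]
  have hS := div_eight_le_integral_gaussian_mul_oddPacket_sq hR0 hRy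
  have hw := continuous_oddPacket R y₀
  have hu := continuous_gaussian R
  have hSw : ∫ x, gaussian R x * oddPacket R y₀ x ^ 2 ≤ ∫ x, oddPacket R y₀ x ^ 2 := by
    have hwi : Integrable fun x => oddPacket R y₀ x ^ 2 := by
      refine (integrable_gaussian hR0).mono' (by fun_prop) (.of_forall fun x => ?_)
      rw [Real.norm_eq_abs, abs_pow, sq]
      exact (mul_le_of_le_one_right (abs_nonneg _)
        ((abs_oddPacket_le R y₀ x).trans (gaussian_le_one R x))).trans (abs_oddPacket_le R y₀ x)
    refine integral_mono_of_nonneg (.of_forall fun x => ?_) hwi (.of_forall fun x => ?_)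
    · exact mul_nonneg (gaussian_pos R x).le (sq_nonneg _)
    · exact mul_le_of_le_one_left (sq_nonneg _) (gaussian_le_one R x)
  have hPS : P * (∫ x, oddPacket R y₀ x ^ 2) ≤ P * (R / 8) :=
    mul_le_mul_of_nonpos_left (hS.trans hSw) hP
  have e1 : K₁ * R * (1 / R + 1 / R) = 2 * K₁ := by field_simp; ring
  have e2 : q ^ 2 * K₂ * R ^ 2 * (1 / R) = K₂ * (q ^ 2 * R) := by field_simp
  rw [e1, e2]
  have e3 : A ^ 2 * (P * (∫ x, oddPacket R y₀ x ^ 2) + 2 * K₁)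
      ≤ A ^ 2 * (P * (R / 8) + (2 * K₁ + K₂)) := by gcongr; linarith
  have e4 : 0 ≤ K₁ * (q ^ 2 * R) := by positivity
  linarith

/-- Comparison of a constrained minimum with the energies of resonant wave packets of amplitude
`A` and width `R`. -/
theorem IsConstrainedMinimizer.energyE_le {γ ε μ a b c ω lam : ℝ} {ξ₀ ν₀ : ℝ → ℝ} (hγ0 : 0 < γ)
    (hγ1 : γ < 1) (hε : 0 < ε) (hmin : IsConstrainedMinimizer γ ε μ a b c ω lam ξ₀ ν₀) (α : ℝ)
    {y₀ : ℝ} (hy₀ : 0 < y₀) (hP : pairSymbol γ μ a b c ω α (2 * Real.pi * y₀) ≤ 0) :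
    ∃ K, 0 ≤ K ∧ ∀ R, 1 ≤ R → 1 ≤ R * y₀ → ∀ A, 0 < A →
      energyE γ μ a b c ω ξ₀ ν₀ ≤
        A ^ 2 * (pairSymbol γ μ a b c ω α (2 * Real.pi * y₀) * (R / 8) + K) + K / (A ^ 4 * R) := by
  obtain ⟨K, hK, h⟩ := energyE_packet_le μ a b c ω α hγ1 hy₀ hP
  set κ := 2 * γ * lam / ε with hκ
  -- The coefficient `q` of the Gaussian is fixed by the constraint.
  refine ⟨K + 64 * K * κ ^ 2, by positivity, fun R hR hRy A hA => ?_⟩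
  have hR0 : 0 < R := by linarith
  have hS := div_eight_le_integral_gaussian_mul_oddPacket_sq hR0 hRy
  set S := ∫ x, gaussian R x * oddPacket R y₀ x ^ 2 with hSdef
  have hS0 : 0 < S := by linarith
  set q := κ / (A ^ 2 * S) with hq
  have hF : constraintF γ ε (fun x => α * A * oddPacket R y₀ x + q * gaussian R x)
      (fun x => A * oddPacket R y₀ x + 0 * gaussian R x) = lam := by
    rw [constraintF_packet γ ε hR0, ← hSdef, hq, hκ]
    field_simp
  refine (hmin.minimal _ _ (memHs_one_packet hR0 y₀ _ _) (memHs_one_packet hR0 y₀ _ _) hF).trans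
    ((h R hR hRy A q).trans ?_)
  have hq2 : q ^ 2 * R ≤ 64 * κ ^ 2 / (A ^ 4 * R) := by
    have h1 : q ^ 2 * R = κ ^ 2 * R / (A ^ 4 * S ^ 2) := by rw [hq]; field_simp
    have h2 : (R / 8) ^ 2 ≤ S ^ 2 := pow_le_pow_left₀ (by positivity) hS 2
    calc q ^ 2 * R = κ ^ 2 * R / (A ^ 4 * S ^ 2) := h1
      _ ≤ κ ^ 2 * R / (A ^ 4 * (R / 8) ^ 2) := by gcongr
      _ = _ := by field_simp; norm_num
  have h3 : K * (q ^ 2 * R) ≤ 64 * K * κ ^ 2 / (A ^ 4 * R) := by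
    refine (mul_le_mul_of_nonneg_left hq2 hK).trans_eq ?_
    ring
  have h4 : 64 * K * κ ^ 2 / (A ^ 4 * R) ≤ (K + 64 * K * κ ^ 2) / (A ^ 4 * R) := by
    gcongr; linarith
  have h5 : 0 ≤ A ^ 2 * (64 * K * κ ^ 2) := by positivity
  linarith

theorem symJc_pos {μ c : ℝ} (hμ : 0 < μ) (hc : c < 0) (θ : ℝ) : 0 < symJc μ c θ := by
  have : 0 ≤ μ * -c * θ ^ 2 := by
    have : 0 ≤ -c := by linarith
    positivity
  rw [symJc]
  linarith

/-- Completing the square in the energy density. -/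
theorem mul_energyDensity_ge {γ μ a b c ω : ℝ} (X Y : ℝ → ℂ) (y : ℝ) :
    ((1 - γ) * symJc μ c (2 * Real.pi * y) * symL γ μ a (2 * Real.pi * y)
      - (ω * symJb μ b (2 * Real.pi * y)) ^ 2) * ‖Y y‖ ^ 2
      ≤ 2 * ((1 - γ) * symJc μ c (2 * Real.pi * y)) * energyDensity γ μ a b c ω X Y y := by
  set J := (1 - γ) * symJc μ c (2 * Real.pi * y) with hJ
  set B := ω * symJb μ b (2 * Real.pi * y) with hB
  have e : (X y * (starRingEnd ℂ) (Y y)).re = (X y).re * (Y y).re + (X y).im * (Y y).im := by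
    simp [Complex.mul_re]
  have nX : ‖X y‖ ^ 2 = (X y).re ^ 2 + (X y).im ^ 2 := by
    rw [← Complex.normSq_eq_norm_sq, Complex.normSq_apply]; ring
  have nY : ‖Y y‖ ^ 2 = (Y y).re ^ 2 + (Y y).im ^ 2 := by
    rw [← Complex.normSq_eq_norm_sq, Complex.normSq_apply]; ring
  have e2 : energyDensity γ μ a b c ω X Y y = J / 2 * ‖X y‖ ^ 2
      + 1 / 2 * symL γ μ a (2 * Real.pi * y) * ‖Y y‖ ^ 2
      - B * (X y * (starRingEnd ℂ) (Y y)).re := by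
    rw [energyDensity, hJ, hB]; ring
  rw [e2, e, nX, nY]
  nlinarith [sq_nonneg (J * (X y).re - B * (Y y).re), sq_nonneg (J * (X y).im - B * (Y y).im)]

theorem symbol_det_zero_pos {γ μ a b c ω : ℝ} (hγ0 : 0 < γ) (hγ1 : γ < 1) (hω : |ω| < 1 - γ) :
    (ω * symJb μ b 0) ^ 2 < (1 - γ) * symJc μ c 0 * symL γ μ a 0 := by
  have h1 : ω ^ 2 < (1 - γ) ^ 2 := by
    rw [← sq_abs]; exact pow_lt_pow_left₀ hω (abs_nonneg ω) two_ne_zero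
  have h2 : (1 - γ) ^ 2 ≤ (1 - γ) * (1 / γ) := by
    rw [sq]
    refine mul_le_mul_of_nonneg_left ?_ (by linarith)
    rw [le_div_iff₀ hγ0]
    nlinarith
  simp only [symJb, symJc, symL, abs_zero]
  ring_nf at h1 h2 ⊢
  linarith

/-- A constrained minimizer at a positive level exists only if the symbol of `E` is positive
definite. If the symbol were degenerate or indefinite at some frequency, packets at that frequency
with a small resonant mean part would satisfy the constraint with energy tending to zero or to
`-∞`. Then the minimum would be zero, with a degenerate nonnegative symbol, which forces the
minimizer to vanish. -/
theorem IsConstrainedMinimizer.symbolPosDef {γ ε μ a b c ω lam : ℝ} {ξ₀ ν₀ : ℝ → ℝ} (hγ0 : 0 < γ)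
    (hγ1 : γ < 1) (hε : 0 < ε) (hμ : 0 < μ) (hc : c < 0) (hω : |ω| < 1 - γ) (hlam : 0 < lam)
    (hmin : IsConstrainedMinimizer γ ε μ a b c ω lam ξ₀ ν₀) : SymbolPosDef γ μ a b c ω := by
  set det : ℝ → ℝ := fun θ =>
    (1 - γ) * symJc μ c θ * symL γ μ a θ - (ω * symJb μ b θ) ^ 2 with hdet
  have hdet_poly : ∀ θ, (detPoly γ μ a b c ω).eval |θ| = det θ := eval_detPoly γ μ a b c ω
  have hdet0 : 0 < det 0 := by
    have := symbol_det_zero_pos (μ := μ) (a := a) (b := b) (c := c) hγ0 hγ1 hω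
    simp only [hdet]
    linarith
  have hJ : ∀ θ, 0 < (1 - γ) * symJc μ c θ := fun θ =>
    mul_pos (by linarith) (symJc_pos hμ hc θ)
  set E₀ := energyE γ μ a b c ω ξ₀ ν₀ with hE₀
  -- Packets at a frequency where the determinant is not positive.
  have hpacket : ∀ θ, det θ ≤ 0 → ∃ y₀ K, 0 < y₀ ∧ 0 ≤ K ∧ ∀ R, 1 ≤ R → 1 ≤ R * y₀ → ∀ A, 0 < A →
      E₀ ≤ A ^ 2 * (det θ / (2 * ((1 - γ) * symJc μ c θ)) * (R / 8) + K) + K / (A ^ 4 * R) := by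
    intro θ hθ
    have hθ0 : θ ≠ 0 := by rintro rfl; linarith
    set y₀ := |θ| / (2 * Real.pi) with hy₀
    have hy : 2 * Real.pi * y₀ = |θ| := by
      rw [hy₀]; have := Real.pi_pos; field_simp
    have hy0 : 0 < y₀ := div_pos (abs_pos.2 hθ0) Real.two_pi_pos
    -- This choice of `α` minimizes the quadratic form at the frequency `θ`.
    set α := ω * symJb μ b θ / ((1 - γ) * symJc μ c θ) with hα
    have hpair : pairSymbol γ μ a b c ω α (2 * Real.pi * y₀)
        = det θ / (2 * ((1 - γ) * symJc μ c θ)) := by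
      have h1 : pairSymbol γ μ a b c ω α (2 * Real.pi * y₀) = pairSymbol γ μ a b c ω α θ := by
        rw [hy]; simp only [pairSymbol, symJc, symL, symJb, abs_abs, sq_abs]
      have h2 := (hJ θ).ne'
      have h3 : α * ((1 - γ) * symJc μ c θ) = ω * symJb μ b θ := by
        rw [hα, div_mul_cancel₀ _ h2]
      rw [h1, eq_div_iff (by positivity)]
      simp only [pairSymbol, hdet]
      linear_combination (α * ((1 - γ) * symJc μ c θ) - ω * symJb μ b θ) * h3
    have hP : pairSymbol γ μ a b c ω α (2 * Real.pi * y₀) ≤ 0 := by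
      rw [hpair]
      exact div_nonpos_of_nonpos_of_nonneg hθ (by have := hJ θ; positivity)
    obtain ⟨K, hK, h⟩ := hmin.energyE_le hγ0 hγ1 hε α hy0 hP
    rw [hpair] at h
    exact ⟨y₀, K, hy0, hK, h⟩
  have hsemi : ∀ θ, 0 ≤ det θ := by
    intro θ
    by_contra! hneg
    obtain ⟨y₀, K, hy₀, hK, h⟩ := hpacket θ hneg.le
    have hP : det θ / (2 * ((1 - γ) * symJc μ c θ)) < 0 :=
      div_neg_of_neg_of_pos hneg (by have := hJ θ; positivity)
    set P := det θ / (2 * ((1 - γ) * symJc μ c θ))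
    -- With `A = 1`, the energy tends to `-∞` with the width of the packet.
    set R := 1 + 1 / y₀ + (2 * K + |E₀| + 1) * 8 / (-P) with hR
    have hP' : 0 < -P := by linarith
    have r1 : 0 ≤ 1 / y₀ := by positivity
    have r2 : 0 ≤ (2 * K + |E₀| + 1) * 8 / (-P) := by positivity
    have hR1 : 1 ≤ R := by linarith
    have hRy : 1 ≤ R * y₀ := by
      have : 1 / y₀ * y₀ = 1 := by field_simp
      nlinarith
    have h1 := h R hR1 hRy 1 one_pos
    have h2 : K / (1 ^ 4 * R) ≤ K := div_le_self hK (by linarith)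
    have h3 : P * R ≤ -((2 * K + |E₀| + 1) * 8) := by
      have h4 : (2 * K + |E₀| + 1) * 8 / (-P) ≤ R := by linarith
      rw [div_le_iff₀ hP'] at h4
      linarith
    have := neg_abs_le E₀
    linarith
  have hE₀nonpos : ∀ θ, det θ = 0 → E₀ ≤ 0 := by
    intro θ hθ
    by_contra! hpos
    obtain ⟨y₀, K, hy₀, hK, h⟩ := hpacket θ hθ.le
    -- Both remaining terms are made at most `E₀ / 4`: the first by `A`, the second by `R`.
    set A := √(E₀ / (4 * (K + 1))) with hA
    have hA2 : A ^ 2 = E₀ / (4 * (K + 1)) := Real.sq_sqrt (by positivity)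
    have hA0 : 0 < A := Real.sqrt_pos.2 (by positivity)
    set R := 1 + 1 / y₀ + 4 * (K / A ^ 4) / E₀ with hR
    have r1 : 0 ≤ 1 / y₀ := by positivity
    have r2 : 0 ≤ 4 * (K / A ^ 4) / E₀ := by positivity
    have hR1 : 1 ≤ R := by linarith
    have hRy : 1 ≤ R * y₀ := by
      have : 1 / y₀ * y₀ = 1 := by field_simp
      nlinarith
    have h1 := h R hR1 hRy A hA0
    rw [hθ, zero_div, zero_mul, zero_add] at h1
    have h2 : A ^ 2 * K ≤ E₀ / 4 := by
      rw [hA2, div_mul_eq_mul_div, div_le_div_iff₀ (by positivity) (by norm_num)]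
      nlinarith
    have h3 : K / (A ^ 4 * R) ≤ E₀ / 4 := by
      rw [← div_div, div_le_iff₀ (by linarith)]
      have h4 : 4 * (K / A ^ 4) / E₀ ≤ R := by linarith
      rw [div_le_iff₀ hpos] at h4
      linarith
    linarith
  intro θ
  by_contra hθ
  have hθ0 : det θ = 0 := le_antisymm (by simp only [hdet]; linarith) (hsemi θ)
  have hE := hE₀nonpos θ hθ0
  have hdens := integrable_energyDensity γ μ a b c ω hmin.memH1_fst hmin.memH1_snd
  have hnn : ∀ y, 0 ≤ energyDensity γ μ a b c ω (fourierL2 ξ₀) (fourierL2 ν₀) y := fun y => by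
    have h1 := mul_energyDensity_ge (γ := γ) (μ := μ) (a := a) (b := b) (c := c) (ω := ω)
      (fourierL2 ξ₀) (fourierL2 ν₀) y
    have h2 := mul_nonneg (hsemi (2 * Real.pi * y)) (sq_nonneg ‖fourierL2 ν₀ y‖)
    have h3 := hJ (2 * Real.pi * y)
    exact nonneg_of_mul_nonneg_right (h2.trans h1) (by positivity)
  have hzero : energyDensity γ μ a b c ω (fourierL2 ξ₀) (fourierL2 ν₀) =ᵐ[volume] 0 :=
    (integral_eq_zero_iff_of_nonneg hnn hdens).1 (le_antisymm hE (integral_nonneg hnn))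
  -- The determinant vanishes only at finitely many frequencies.
  have hfin : ∀ᵐ y : ℝ, det (2 * Real.pi * y) ≠ 0 := by
    have hne : detPoly γ μ a b c ω ≠ 0 := by
      intro h0
      have := hdet_poly 0
      rw [h0, Polynomial.eval_zero] at this
      linarith
    have hf : {y : ℝ | det (2 * Real.pi * y) = 0}.Finite := by
      have hroots := (detPoly γ μ a b c ω).roots.toFinset.finite_toSet
      have hpre := (hroots.image fun t => t / (2 * Real.pi)).union
        (hroots.image fun t => -(t / (2 * Real.pi)))
      refine hpre.subset fun y hy => ?_
      have hr : |2 * Real.pi * y| ∈ ((detPoly γ μ a b c ω).roots.toFinset : Set ℝ) := by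
        rw [Finset.mem_coe, Multiset.mem_toFinset, Polynomial.mem_roots hne, Polynomial.IsRoot,
          hdet_poly]
        exact hy
      have hpi := Real.pi_pos
      rcases abs_choice (2 * Real.pi * y) with h | h
      · exact Or.inl ⟨_, hr, by rw [h]; field_simp⟩
      · exact Or.inr ⟨_, hr, by rw [h]; field_simp⟩
    exact compl_mem_ae_iff.2 (hf.measure_zero volume)
  have hν0 : ∀ᵐ y, fourierL2 ν₀ y = 0 := by
    filter_upwards [hzero, hfin] with y h0 h1
    have h2 := mul_energyDensity_ge (γ := γ) (μ := μ) (a := a) (b := b) (c := c) (ω := ω)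
      (fourierL2 ξ₀) (fourierL2 ν₀) y
    rw [h0, Pi.zero_apply, mul_zero] at h2
    have h3 : 0 < det (2 * Real.pi * y) := lt_of_le_of_ne (hsemi _) h1.symm
    have h4 : ‖fourierL2 ν₀ y‖ ^ 2 ≤ 0 := by
      by_contra! h5
      have := mul_pos h3 h5
      simp only [hdet] at this
      linarith
    exact norm_eq_zero.1 (pow_eq_zero_iff two_ne_zero |>.1 (le_antisymm h4 (sq_nonneg _)))
  have hL2 := (memHs_iff.1 hmin.memH1_snd).1
  have hν : cplx ν₀ =ᵐ[volume] 0 := by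
    have h1 := cplx_ae_eq_fourierInv hL2 (integrable_fourierL2_of_memHs_one hmin.memH1_snd)
    refine h1.trans (.of_forall fun x => ?_)
    rw [Real.fourierInv_eq]
    refine integral_eq_zero_of_ae ?_
    filter_upwards [hν0] with y hy
    simp [hy]
  have hF := hmin.constraint
  have hint : ∫ x, ξ₀ x * ν₀ x ^ 2 = 0 := by
    refine integral_eq_zero_of_ae ?_
    filter_upwards [hν] with x hx
    have : ν₀ x = 0 := by simpa [cplx] using hx
    simp [this]
  rw [constraintF, hint, mul_zero] at hF
  linarith

end

end BFD

theorem theorem4p1 (γ ε μ a b c ω : ℝ)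
    (hγ0 : 0 < γ) (hγ1 : γ < 1) (hε : 0 < ε) (hμ : 0 < μ)
    (hb : 0 < b) (ha : a ≤ 0) (hc : c ≤ 0)
    (hω : |ω| < (1 - γ) * min 1 (|c| / b))
    (ξ ν : ℝ → ℝ) (hξ : Continuous ξ) (hν : Continuous ν)
    (hsol : BFD.IsSolitaryWave γ ε μ a b c ω ξ ν)
    (horigin : (∃ K : ℝ, 0 < K ∧ ∃ lam : ℝ, 0 < lam ∧ ∃ ξ₀ ν₀ : ℝ → ℝ,
          BFD.IsConstrainedMinimizer γ ε μ a b c ω lam ξ₀ ν₀ ∧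
          (∀ x, ξ x = K * ξ₀ x) ∧ (∀ x, ν x = K * ν₀ x))
      ∨ BFD.SymbolPosDef γ μ a b c ω) :
    BFD.MemHInfty ξ ∧ BFD.MemHInfty ν ∧
      ∃ D : ℝ, ∀ x : ℝ, x ^ 2 * |ξ x| ≤ D ∧ x ^ 2 * |ν x| ≤ D := by
  have hγ : 0 < 1 - γ := by linarith
  -- The condition on `ω` excludes `c = 0`.
  have hc' : c < 0 := by
    refine lt_of_le_of_ne hc ?_
    rintro rfl
    simp only [abs_zero, zero_div] at hω
    rw [min_eq_right zero_le_one, mul_zero] at hω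
    exact absurd hω (not_lt.2 (abs_nonneg ω))
  have hω' : |ω| < 1 - γ :=
    hω.trans_le (mul_le_of_le_one_right hγ.le (min_le_left _ _))
  have hpos : BFD.SymbolPosDef γ μ a b c ω := by
    rcases horigin with ⟨K, -, lam, hlam, ξ₀, ν₀, hmin, -, -⟩ | h
    · exact hmin.symbolPosDef hγ0 hγ1 hε hμ hc' hω' hlam
    · exact h
  exact BFD.memHInfty_and_decay_of_symbolPosDef hγ0 hγ1 hμ hc' hξ hν hsol hpos
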